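/- Let $n\ge 1$, let $\mathbb{S}^{2n+1}$ be the unit sphere of $\mathbb{R}^{2n+2}=\mathbb{R}^{n+1}\times\mathbb{R}^{n+1}$, let $\Sigma_0=\mathbb{S}^n(1/\sqrt2)\times\mathbb{S}^n(1/\sqrt2)\subset\mathbb{S}^{2n+1}$ be the minimal Clifford torus, and let $\widehat\Sigma_0=\{rp : r>0,\ p\in\Sigma_0\}\subset\mathbb{R}^{2n+2}$ be the cone over it. Put $J=\begin{pmatrix}0&-\mathrm{Id}\\ \mathrm{Id}&0\end{pmatrix}$ with blocks of order $n+1$, and for $a,k>0$ consider the $a$-pitched twistings $$\Sigma(a,k)=\{(e^{ksJ}p,as) : p\in\Sigma_0,\ s\in\mathbb{R}\}\subset\mathbb{S}^{2n+1}\times\mathbb{R},\qquad \widehat\Sigma(a,k)=\{(e^{ksJ}p,as) : p\in\widehat\Sigma_0,\ s\in\mathbb{R}\}\subset\mathbb{R}^{2n+2}\times\mathbb{R}.$$ Definitions. Let $M$ be a Riemannian manifold, and let $M\times\mathbb{R}$ carry the product metric $\langle\,,\,\rangle=\langle\,,\,\rangle_M+dt^2$ with Levi-Civita connection $\overline\nabla$.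 For an orientable hypersurface $\Sigma\subset M\times\mathbb{R}$ with unit normal field $N$, let $AX=-\overline\nabla_XN$ be its shape operator, $H=\operatorname{trace}A$ its mean curvature, $\xi$ its height function (the restriction of $(x,t)\mapsto t$) and $\theta=\langle N,\partial_t\rangle$ its angle function. $\Sigma$ is a vertical helicoid if $\nabla\xi$ vanishes nowhere on $\Sigma$, $\theta$ is not constant, every horizontal section $\Sigma\cap(M\times\{t\})$ is a minimal hypersurface of $M\times\{t\}$, and $\langle A\nabla\xi,\nabla\xi\rangle=0$ on $\Sigma$. A hypersurface is spacelike if the Lorentzian metric $\langle\,,\,\rangle_L=\langle\,,\,\rangle_M-dt^2$ is positive definite on it; a spacelike hypersurface is zero mean isocurved if $H=0$ and $H_L=0$, where $H_L=\operatorname{trace}(X\mapsto\overline\nabla_XN_L)$ for a normal field $N_L$ with respect to $\langle\,,\,\rangle_L$ such that $\langle N_L,N_L\rangle_L=-1$. Then: 1. For all $a,k>0$, $\Sigma(a,k)$ is a properly embedded vertical helicoid in $\mathbb{S}^{2n+1}\times\mathbb{R}$. 2. For every $a>0$ there is $k>0$ such that $\Sigma(a,k)$ contains a nonempty open subset that is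 spacelike and zero mean isocurved in $\mathbb{S}^{2n+1}\times\mathbb{R}$. 3. For all $a,k>0$, $\widehat\Sigma(a,k)$ is an embedded vertical helicoid in $\mathbb{R}^{2n+2}\times\mathbb{R}$. 4. For every $a>0$ there is $k>0$ such that $\widehat\Sigma(a,k)$ contains a nonempty open subset that is spacelike and zero mean isocurved in $\mathbb{R}^{2n+2}\times\mathbb{R}$. -/

import Mathlib

open scoped ContDiff Topology RealInnerProductSpace

noncomputable section

/-! ### Submanifolds of a Euclidean vector space

Riemannian manifolds are realized as embedded submanifolds `P` of a finite-dimensional real inner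
product space `V`, with the induced metric. -/

section Submanifolds

variable {V : Type*} [NormedAddCommGroup V] [InnerProductSpace ℝ V] [FiniteDimensional ℝ V]

/-- `S` is a `d`-dimensional embedded `C^∞` submanifold of `V`: near each of its points it is the
zero set of a smooth map to `ℝ^c`, `c + d = dim V`, whose differential is onto along `S`. -/
def IsEmbeddedSubmanifold (S : Set V) (d : ℕ) : Prop :=
  ∃ c : ℕ, c + d = Module.finrank ℝ V ∧
    ∀ p ∈ S, ∃ U : Set V, IsOpen U ∧ p ∈ U ∧ ∃ f : V → EuclideanSpace ℝ (Fin c),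
      ContDiffOn ℝ ∞ f U ∧ (∀ q ∈ U, q ∈ S ↔ f q = 0) ∧
      ∀ q ∈ S ∩ U, Function.Surjective (fderiv ℝ f q)

/-- The tangent space of `S` at `p`: the space of velocities at `p` of smooth curves in `S`.
(For a submanifold the set of velocities is already a linear subspace.) -/
def tangentSpaceAt (S : Set V) (p : V) : Submodule ℝ V :=
  Submodule.span ℝ {v | ∃ γ : ℝ → V, ContDiffAt ℝ ∞ γ 0 ∧ (∀ᶠ t in 𝓝 (0 : ℝ), γ t ∈ S) ∧
    γ 0 = p ∧ HasDerivAt γ v 0}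

/-- `S` is an embedded hypersurface of the embedded submanifold `P`. -/
def IsEmbeddedHypersurface (P S : Set V) : Prop :=
  S ⊆ P ∧ ∃ d : ℕ, IsEmbeddedSubmanifold P (d + 1) ∧ IsEmbeddedSubmanifold S d

/-- The hypersurface `S` of `P` is properly embedded: the inclusion `S → P` is moreover proper. -/
def IsProperlyEmbeddedHypersurface (P S : Set V) : Prop :=
  IsEmbeddedHypersurface P S ∧ ∃ h : S ⊆ P, IsProperMap (Set.inclusion h)

/-- `N` restricts to a smooth vector field of `P` along `S`. -/
def IsSmoothFieldAlong (P S : Set V) (N : V → V) : Prop :=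
  (∃ U : Set V, IsOpen U ∧ S ⊆ U ∧ ContDiffOn ℝ ∞ N U) ∧ ∀ p ∈ S, N p ∈ tangentSpaceAt P p

/-- `N` is a smooth unit normal field of the hypersurface `S` of `P`. -/
def IsUnitNormalField (P S : Set V) (N : V → V) : Prop :=
  IsSmoothFieldAlong P S N ∧ ∀ p ∈ S, ‖N p‖ = 1 ∧ ∀ X ∈ tangentSpaceAt S p, ⟪X, N p⟫ = 0

/-- The Levi-Civita derivative of `P` at `p`, applied to a field `N`: the orthogonal projection to
`T_p P` of the derivative of `N` in `V`. It is used on directions tangent to `P`. -/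
def covariantDerivative (P : Set V) (N : V → V) (p : V) : V →L[ℝ] V :=
  (tangentSpaceAt P p).starProjection ∘L fderiv ℝ N p

/-- The shape operator `A X = -∇_X N` of the hypersurface `S` of `P`, as an endomorphism of `T_p S`.
For a unit normal `N` the vector `∇_X N` lies in `T_p S`, so that the projection to
`T_p S` only adjusts the codomain. -/
def shapeOperator (P S : Set V) (N : V → V) (p : V) :
    tangentSpaceAt S p →ₗ[ℝ] tangentSpaceAt S p :=
  -((tangentSpaceAt S p).orthogonalProjectionOnto ∘L covariantDerivative P N p ∘L
    (tangentSpaceAt S p).subtypeL).toLinearMap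

/-- The (non-normalized) mean curvature `H = trace A`. -/
def meanCurvature (P S : Set V) (N : V → V) (p : V) : ℝ :=
  LinearMap.trace ℝ (tangentSpaceAt S p) (shapeOperator P S N p)

/-- `S` is a minimal hypersurface of `P`: its mean curvature with respect to any local unit normal
field vanishes. -/
def IsMinimalHypersurface (P S : Set V) : Prop :=
  IsEmbeddedHypersurface P S ∧
    ∀ W : Set V, IsOpen W → ∀ N : V → V, IsUnitNormalField P (S ∩ W) N →
      ∀ p ∈ S ∩ W, meanCurvature P (S ∩ W) N p = 0

end Submanifolds

/-! ### Hypersurfaces of `M × ℝ`, for a submanifold `M` of a Euclidean vector space `E` -/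

section Product

variable {E : Type*} [NormedAddCommGroup E] [InnerProductSpace ℝ E] [FiniteDimensional ℝ E]

/-- `M × ℝ` inside the Euclidean product `E × ℝ`. -/
def cylinder (M : Set E) : Set (WithLp 2 (E × ℝ)) := {x | x.fst ∈ M}

/-- The horizontal section `M_t = M × {t}`. -/
def horizontalSlice (M : Set E) (t : ℝ) : Set (WithLp 2 (E × ℝ)) := {x | x.fst ∈ M ∧ x.snd = t}

/-- The vertical field `∂_t`. -/
def verticalVector : WithLp 2 (E × ℝ) := WithLp.toLp 2 (0, 1)

/-- The angle function `θ = ⟨N, ∂_t⟩`. -/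
def angleFunction (N : WithLp 2 (E × ℝ) → WithLp 2 (E × ℝ)) (p : WithLp 2 (E × ℝ)) : ℝ :=
  ⟪N p, verticalVector⟫

/-- The gradient on `S` of the height function, the restriction of `(x, t) ↦ t` to `S`: as `∂_t`
is the gradient of `(x, t) ↦ t`, this is the projection of `∂_t` to `T_p S`. -/
def heightGradient (S : Set (WithLp 2 (E × ℝ))) (p : WithLp 2 (E × ℝ)) : tangentSpaceAt S p :=
  (tangentSpaceAt S p).orthogonalProjectionOnto verticalVector

/-- `S` is a vertical helicoid of `M × ℝ`: an orientable hypersurface without horizontal points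
and with nonconstant angle function, whose horizontal sections are minimal in `M × {t}`, and for
which the gradient of the height function is an asymptotic direction. -/
structure IsVerticalHelicoid (M : Set E) (S : Set (WithLp 2 (E × ℝ))) : Prop where
  hypersurface : IsEmbeddedHypersurface (cylinder M) S
  orientable : ∃ N, IsUnitNormalField (cylinder M) S N
  no_horizontal_point : ∀ p ∈ S, heightGradient S p ≠ 0
  angle_nonconstant : ∀ N, IsUnitNormalField (cylinder M) S N →
    ∃ p ∈ S, ∃ q ∈ S, angleFunction N p ≠ angleFunction N q
  sections_minimal : ∀ t : ℝ,
    IsMinimalHypersurface (horizontalSlice M t) (horizontalSlice M t ∩ S)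
  asymptotic : ∀ N, IsUnitNormalField (cylinder M) S N → ∀ p ∈ S,
    ⟪shapeOperator (cylinder M) S N p (heightGradient S p), heightGradient S p⟫ = 0

/-- The Lorentzian product metric `⟨ , ⟩_M - dt²`. -/
def lorentzForm (X Y : WithLp 2 (E × ℝ)) : ℝ := ⟪X.fst, Y.fst⟫ - X.snd * Y.snd

/-- The Lorentzian metric is positive definite on `S`. -/
def IsSpacelike (S : Set (WithLp 2 (E × ℝ))) : Prop :=
  ∀ p ∈ S, ∀ X ∈ tangentSpaceAt S p, X ≠ 0 → 0 < lorentzForm X X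

/-- `N` is a smooth Lorentzian (timelike) unit normal field of the hypersurface `S` of `M × ℝ`. -/
def IsLorentzUnitNormalField (M : Set E) (S : Set (WithLp 2 (E × ℝ)))
    (N : WithLp 2 (E × ℝ) → WithLp 2 (E × ℝ)) : Prop :=
  IsSmoothFieldAlong (cylinder M) S N ∧
    ∀ p ∈ S, lorentzForm (N p) (N p) = -1 ∧ ∀ X ∈ tangentSpaceAt S p, lorentzForm X (N p) = 0

/-- The Lorentzian mean curvature `H_L = -trace A_L`, `A_L X = -∇_X N_L`. The Riemannian and the
Lorentzian product metrics of `M × ℝ` have the same Levi-Civita connection, and `∇_X N_L`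
again lies in `T_p S`, so `A_L` is given by the same formula as the Riemannian shape operator. -/
def lorentzMeanCurvature (M : Set E) (S : Set (WithLp 2 (E × ℝ)))
    (N : WithLp 2 (E × ℝ) → WithLp 2 (E × ℝ)) (p : WithLp 2 (E × ℝ)) : ℝ :=
  -LinearMap.trace ℝ (tangentSpaceAt S p) (shapeOperator (cylinder M) S N p)

/-- `S` is a spacelike zero mean isocurved hypersurface of `M × ℝ`: `H = H_L = 0` (for either
choice of unit normals). -/
structure IsZeroMeanIsocurved (M : Set E) (S : Set (WithLp 2 (E × ℝ))) : Prop where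
  hypersurface : IsEmbeddedHypersurface (cylinder M) S
  spacelike : IsSpacelike S
  orientable : ∃ N, IsUnitNormalField (cylinder M) S N
  lorentz_orientable : ∃ N, IsLorentzUnitNormalField M S N
  meanCurvature_eq_zero : ∀ N, IsUnitNormalField (cylinder M) S N →
    ∀ p ∈ S, meanCurvature (cylinder M) S N p = 0
  lorentzMeanCurvature_eq_zero : ∀ N, IsLorentzUnitNormalField M S N →
    ∀ p ∈ S, lorentzMeanCurvature M S N p = 0

/-- `S` contains a nonempty, relatively open, spacelike zero mean isocurved subset. -/
def ContainsOpenZeroMeanIsocurved (M : Set E) (S : Set (WithLp 2 (E × ℝ))) : Prop :=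
  ∃ W : Set (WithLp 2 (E × ℝ)), IsOpen W ∧ (S ∩ W).Nonempty ∧ IsZeroMeanIsocurved M (S ∩ W)

/-- The `a`-pitched twisting `{(Γ_s p, a s) : p ∈ S₀, s ∈ ℝ}` of `S₀` determined by `Γ`. -/
def pitchedTwisting (a : ℝ) (Γ : ℝ → E → E) (S₀ : Set E) : Set (WithLp 2 (E × ℝ)) :=
  {x | ∃ p ∈ S₀, ∃ s : ℝ, x = WithLp.toLp 2 (Γ s p, a * s)}

/-- The cone `{r p : r > 0, p ∈ S₀}` over `S₀`. -/
def coneOver (S₀ : Set E) : Set E := {x | ∃ r : ℝ, 0 < r ∧ ∃ p ∈ S₀, x = r • p}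

end Product

/-! ### Twisted Clifford tori -/

/-- `ℝ^{2n+2} = ℝ^{n+1} × ℝ^{n+1}`. -/
abbrev DoubleSpace (n : ℕ) : Type := EuclideanSpace ℝ (Fin (n + 1) ⊕ Fin (n + 1))

/-- The unit sphere `S^{2n+1}` of `ℝ^{2n+2}`. -/
def oddSphere (n : ℕ) : Set (DoubleSpace n) := Metric.sphere 0 1

/-- The Clifford torus `S^n(1/√2) × S^n(1/√2)`. -/
def cliffordTorus (n : ℕ) : Set (DoubleSpace n) :=
  {p | (WithLp.toLp 2 fun i => p (Sum.inl i) : EuclideanSpace ℝ (Fin (n + 1))) ∈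
        Metric.sphere 0 (1 / √2) ∧
      (WithLp.toLp 2 fun i => p (Sum.inr i) : EuclideanSpace ℝ (Fin (n + 1))) ∈
        Metric.sphere 0 (1 / √2)}

/-- The one-parameter group `s ↦ e^{(ks)J}` acting on `ℝ^{2n+2}`, where `J` is the block matrix
with rows `(0, -Id)` and `(Id, 0)`. -/
def rotationGroup (n : ℕ) (k s : ℝ) (p : DoubleSpace n) : DoubleSpace n :=
  Matrix.toEuclideanLin (NormedSpace.exp ((k * s) • Matrix.J (Fin (n + 1)) ℝ)) p

/-- The twisted Clifford torus `Σ(a, k)`. -/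
def twistedCliffordTorus (n : ℕ) (a k : ℝ) : Set (WithLp 2 (DoubleSpace n × ℝ)) :=
  pitchedTwisting a (rotationGroup n k) (cliffordTorus n)

/-- The twisting of the cone over the Clifford torus. -/
def twistedCliffordCone (n : ℕ) (a k : ℝ) : Set (WithLp 2 (DoubleSpace n × ℝ)) :=
  pitchedTwisting a (rotationGroup n k) (coneOver (cliffordTorus n))

end

/-!
Let `C (x, y) = (x, -y)` and `T (x, y) = (y, x)`, so that `J = T C` and `C T = -T C`. The cone over
the Clifford torus is `⟪C x, x⟫ = 0`, and since `e^{θJ} C e^{-θJ} = cos 2θ C + sin 2θ T`, both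
twistings are cut out of `M × ℝ`, where `M` is the sphere or the whole space, by the single equation
`u (x, t) = ½ ⟪A x, x⟫ = 0`, where `A = cos (m t) C + sin (m t) T` and `m = 2 k / a`.

For a hypersurface given by an equation, the shape operator is a multiple of the compression of the
Hessian of that equation, so every curvature condition is a statement about the Hessian of `u`. On
`u = 0` the horizontal block of this Hessian is the reflection `A`, which has trace zero because it
anticommutes with another reflection, and the vertical diagonal entry vanishes. The normal
directions that have to be removed from the trace, namely the gradient `(A x, u_t)`, the position
vector `x` when `M` is the sphere, and `∂_t` for the horizontal sections, are all isotropic for the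
Hessian. Hence the trace over the tangent space vanishes as well, and since `∂_t` contributes
nothing to it, the sign of `dt²` is irrelevant: this gives `H = 0` and `H_L = 0` at the same time.
The gradient of the height function is a combination of `∂_t` and the gradient of `u`, hence an
asymptotic direction. The hypersurface is spacelike where `u_t² > |A x|²`, which holds at
`(e_i, e_i) / √2` once `|m| > 2`, while at `(e_i, e_j) / √2` with `i ≠ j` the normal is horizontal.
-/

section TangentSpaces

variable {V F : Type*} [NormedAddCommGroup V] [InnerProductSpace ℝ V]
  [NormedAddCommGroup F] [NormedSpace ℝ F] {S : Set V} {p : V}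

theorem fderiv_eqOn_tangentSpaceAt {f g : V → F} (hf : DifferentiableAt ℝ f p)
    (hg : DifferentiableAt ℝ g p) (hfg : Set.EqOn f g S) :
    Set.EqOn (fderiv ℝ f p) (fderiv ℝ g p) (tangentSpaceAt S p) := by
  refine LinearMap.eqOn_span (f := (fderiv ℝ f p : V →ₗ[ℝ] F)) (g := fderiv ℝ g p) ?_
  rintro v ⟨γ, -, hγS, rfl, hγ⟩
  refine (hf.hasFDerivAt.comp_hasDerivAt (0 : ℝ) hγ).unique
    ((hg.hasFDerivAt.comp_hasDerivAt (0 : ℝ) hγ).congr_of_eventuallyEq ?_)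
  filter_upwards [hγS] with t ht using hfg ht

theorem exists_implicitFunction_contDiffAt [CompleteSpace V] [FiniteDimensional ℝ F]
    {f : V → F} {f' : V →L[ℝ] F} (hf : ContDiffAt ℝ ∞ f p) (hf' : HasFDerivAt f f' p)
    (hsurj : Function.Surjective f') :
    ∃ g : f'.ker → V, ContDiffAt ℝ ∞ g 0 ∧ g 0 = p ∧ HasFDerivAt g f'.ker.subtypeL 0 ∧
      ∀ᶠ v in 𝓝 0, f (g v) = f p := by
  have := FiniteDimensional.complete ℝ F
  have hstrict : HasStrictFDerivAt f f' p := hf.hasStrictFDerivAt' hf' (by simp)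
  have hrange : f'.range = ⊤ := LinearMap.range_eq_top.2 hsurj
  let φ := hstrict.implicitFunctionDataOfComplemented f f' hrange
    f'.ker_closedComplemented_of_finiteDimensional_range
  have hφ : ContDiffAt ℝ ∞ φ.implicitFunction.uncurry (φ.prodFun φ.pt) :=
    ImplicitFunctionData.contDiffAt_implicitFunction hf
      (((ContinuousLinearMap.contDiff _).comp (contDiff_id.sub contDiff_const)).contDiffAt)
      (by simp)
  have hpt : φ.prodFun φ.pt = (f p, 0) := by simp [φ]
  refine ⟨hstrict.implicitFunction f f' hrange (f p), ?_,
    hstrict.implicitFunction_apply_image hrange,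
    (hstrict.to_implicitFunction hrange).hasFDerivAt, ?_⟩
  · rw [hpt] at hφ
    exact hφ.comp (0 : f'.ker) (contDiffAt_const.prodMk contDiffAt_id)
  · exact (Continuous.prodMk_right (f p)).continuousAt.eventually
      (hstrict.map_implicitFunction_eq hrange)

theorem tangentSpaceAt_eq_ker [CompleteSpace V] [FiniteDimensional ℝ F]
    {f : V → F} {f' : V →L[ℝ] F} (hf : ContDiffAt ℝ ∞ f p) (hf' : HasFDerivAt f f' p)
    (hsurj : Function.Surjective f') (hp : p ∈ S) (hS : ∀ᶠ q in 𝓝 p, q ∈ S ↔ f q = 0) :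
    tangentSpaceAt S p = f'.ker := by
  have hfp : f p = 0 := hS.self_of_nhds.1 hp
  refine le_antisymm (Submodule.span_le.2 ?_) fun v hv => Submodule.subset_span ?_
  · rintro v ⟨γ, -, hγS, rfl, hγ⟩
    refine (hf'.comp_hasDerivAt (0 : ℝ) hγ).unique
      ((hasDerivAt_const (0 : ℝ) (0 : F)).congr_of_eventuallyEq ?_)
    filter_upwards [hγS, hγ.continuousAt.eventually hS] with t ht htS using htS.1 ht
  · obtain ⟨g, hg, hg0, hg', hfg⟩ := exists_implicitFunction_contDiffAt hf hf' hsurj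
    let l : ℝ → f'.ker := fun t => t • ⟨v, hv⟩
    have hl0 : l 0 = 0 := zero_smul ℝ _
    have hl : HasDerivAt l ⟨v, hv⟩ 0 := by
      simpa only [id, one_smul] using (hasDerivAt_id (0 : ℝ)).smul_const (⟨v, hv⟩ : f'.ker)
    rw [← hl0] at hg hg' hfg
    have hγ : HasDerivAt (g ∘ l) v 0 := hg'.comp_hasDerivAt (0 : ℝ) hl
    have hγ0 : (g ∘ l) 0 = p := by rw [Function.comp_apply, hl0, hg0]
    refine ⟨g ∘ l, hg.comp (0 : ℝ) (by fun_prop), ?_, hγ0, hγ⟩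
    rw [← hγ0] at hS
    filter_upwards [hγ.continuousAt.eventually hS, hl.continuousAt.eventually hfg] with t htS ht
    exact htS.2 (ht.trans hfp)

end TangentSpaces

section OrthogonalFamilies

variable {ι V : Type*} [NormedAddCommGroup V] [InnerProductSpace ℝ V]

/-- The linear map `X ↦ (⟪w i, X⟫)ᵢ`. For a family of gradients it is the differential of the
corresponding vector-valued function. -/
noncomputable def innerCoordinates (w : ι → V) : V →L[ℝ] EuclideanSpace ℝ ι :=
  (PiLp.continuousLinearEquiv 2 ℝ fun _ : ι => ℝ).symm.toContinuousLinearMap ∘L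
    ContinuousLinearMap.pi fun i => innerSL ℝ (w i)

theorem innerCoordinates_apply (w : ι → V) (X : V) (i : ι) :
    innerCoordinates w X i = ⟪w i, X⟫ := rfl

variable {w : ι → V}

theorem inner_sum_smul_eq_of_pairwise [Fintype ι] (hw : Pairwise fun i j => ⟪w i, w j⟫ = 0)
    (a : ι → ℝ) (j : ι) : ⟪w j, ∑ i, a i • w i⟫ = a j * ⟪w j, w j⟫ := by
  rw [inner_sum, Finset.sum_eq_single_of_mem j (Finset.mem_univ j), inner_smul_right]
  intro i _ hij
  rw [inner_smul_right, hw hij.symm, mul_zero]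

theorem innerCoordinates_surjective [Finite ι] (hw0 : ∀ i, w i ≠ 0)
    (hw : Pairwise fun i j => ⟪w i, w j⟫ = 0) : Function.Surjective (innerCoordinates w) := by
  cases nonempty_fintype ι
  refine fun y => ⟨∑ i, (y i / ⟪w i, w i⟫) • w i, ?_⟩
  ext j
  rw [innerCoordinates_apply, inner_sum_smul_eq_of_pairwise hw,
    div_mul_cancel₀ _ (inner_self_ne_zero.2 (hw0 j))]

variable [Fintype ι] {K : Submodule ℝ V} [K.HasOrthogonalProjection]

theorem starProjection_eq_sub_sum (hw0 : ∀ i, w i ≠ 0)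
    (hw : Pairwise fun i j => ⟪w i, w j⟫ = 0) (hK : ∀ X, X ∈ K ↔ ∀ i, ⟪w i, X⟫ = 0) (v : V) :
    K.starProjection v = v - ∑ i, (⟪w i, v⟫ / ⟪w i, w i⟫) • w i := by
  refine Submodule.eq_starProjection_of_mem_of_inner_eq_zero
    ((hK _).2 fun j => ?_) fun X hX => ?_
  · rw [inner_sub_right, inner_sum_smul_eq_of_pairwise hw,
      div_mul_cancel₀ _ (inner_self_ne_zero.2 (hw0 j)), sub_self]
  · rw [sub_sub_cancel, sum_inner]
    refine Finset.sum_eq_zero fun i _ => ?_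
    rw [real_inner_smul_left, (hK X).1 hX i, mul_zero]

theorem trace_orthogonalProjectionOnto_comp [FiniteDimensional ℝ V] (hw0 : ∀ i, w i ≠ 0)
    (hw : Pairwise fun i j => ⟪w i, w j⟫ = 0) (hK : ∀ X, X ∈ K ↔ ∀ i, ⟪w i, X⟫ = 0)
    (L : V →ₗ[ℝ] V) :
    LinearMap.trace ℝ K (K.orthogonalProjectionOnto.toLinearMap ∘ₗ L ∘ₗ K.subtype) =
      LinearMap.trace ℝ V L - ∑ i, ⟪L (w i), w i⟫ / ⟪w i, w i⟫ := by
  have hL : (L ∘ₗ K.subtype) ∘ₗ K.orthogonalProjectionOnto.toLinearMap =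
      L - ∑ i, (innerSL ℝ (w i)).toLinearMap.smulRight (⟪w i, w i⟫⁻¹ • L (w i)) := by
    ext v
    have hv : (K.orthogonalProjectionOnto v : V) =
      v - ∑ i, (⟪w i, v⟫ / ⟪w i, w i⟫) • w i := starProjection_eq_sub_sum hw0 hw hK v
    simp [hv, smul_smul, div_eq_mul_inv]
  rw [LinearMap.trace_comp_comm', hL, map_sub, map_sum]
  congr 1
  refine Finset.sum_congr rfl fun i _ => ?_
  rw [LinearMap.trace_smulRight, ContinuousLinearMap.coe_coe, innerSL_apply_apply,
    inner_smul_right, real_inner_comm (L (w i)), div_eq_inv_mul]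

end OrthogonalFamilies

/-- `S` is, near itself, the common zero set of finitely many smooth functions whose gradients
`w i` are nonzero and pairwise orthogonal along `S`. -/
structure IsOrthogonalLevelSet {ι V : Type*} [NormedAddCommGroup V] [InnerProductSpace ℝ V]
    (S : Set V) (w : ι → V → V) : Prop where
  exists_equations : ∃ U : Set V, IsOpen U ∧ S ⊆ U ∧ ∃ f : ι → V → ℝ,
    (∀ i, ContDiffOn ℝ ∞ (f i) U) ∧ (∀ q ∈ U, q ∈ S ↔ ∀ i, f i q = 0) ∧
      ∀ q ∈ S, ∀ i, HasFDerivAt (f i) (innerSL ℝ (w i q)) q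
  ne_zero : ∀ q ∈ S, ∀ i, w i q ≠ 0
  pairwise_inner : ∀ q ∈ S, Pairwise fun i j => ⟪w i q, w j q⟫ = 0

namespace IsOrthogonalLevelSet

variable {ι κ V : Type*} [NormedAddCommGroup V] [InnerProductSpace ℝ V]
  {S : Set V} {w : ι → V → V} {p : V}

theorem univ [IsEmpty ι] : IsOrthogonalLevelSet Set.univ w where
  exists_equations := ⟨_, isOpen_univ, subset_rfl, fun _ _ => 0, by simp⟩
  ne_zero _ _ i := isEmptyElim i
  pairwise_inner _ _ i := isEmptyElim i

theorem reindex (h : IsOrthogonalLevelSet S w) (e : κ ≃ ι) :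
    IsOrthogonalLevelSet S (w ∘ e) where
  exists_equations := by
    obtain ⟨U, hU, hSU, f, hf, hmem, hf'⟩ := h.exists_equations
    exact ⟨U, hU, hSU, f ∘ e, fun i => hf (e i),
      fun q hq => (hmem q hq).trans (e.forall_congr_right (q := fun i => f i q = 0)).symm,
      fun q hq i => hf' q hq (e i)⟩
  ne_zero q hq i := h.ne_zero q hq (e i)
  pairwise_inner q hq _ _ hij := h.pairwise_inner q hq (e.injective.ne hij)

theorem inter (h : IsOrthogonalLevelSet S w) {W : Set V} (hW : IsOpen W) :
    IsOrthogonalLevelSet (S ∩ W) w where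
  exists_equations := by
    obtain ⟨U, hU, hSU, f, hf, hmem, hf'⟩ := h.exists_equations
    refine ⟨U ∩ W, hU.inter hW, Set.inter_subset_inter_left W hSU, f,
      fun i => (hf i).mono Set.inter_subset_left, fun q hq => ?_, fun q hq => hf' q hq.1⟩
    rw [Set.mem_inter_iff, and_iff_left hq.2, hmem q hq.1]
  ne_zero q hq := h.ne_zero q hq.1
  pairwise_inner q hq := h.pairwise_inner q hq.1

theorem card_le_finrank [Fintype ι] [FiniteDimensional ℝ V] (h : IsOrthogonalLevelSet S w)
    (hp : p ∈ S) :
    Fintype.card ι ≤ Module.finrank ℝ V :=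
  (linearIndependent_of_ne_zero_of_inner_eq_zero (h.ne_zero p hp)
    (h.pairwise_inner p hp)).fintype_card_le_finrank

theorem exists_submersion [Fintype ι] (h : IsOrthogonalLevelSet S w) :
    ∃ U : Set V, IsOpen U ∧ S ⊆ U ∧ ∃ f : V → EuclideanSpace ℝ ι, ContDiffOn ℝ ∞ f U ∧
      (∀ q ∈ U, q ∈ S ↔ f q = 0) ∧
      ∀ q ∈ S, HasFDerivAt f (innerCoordinates fun i => w i q) q := by
  obtain ⟨U, hU, hSU, f, hf, hmem, hf'⟩ := h.exists_equations
  refine ⟨U, hU, hSU, fun q => WithLp.toLp 2 fun i => f i q, contDiffOn_euclidean.2 hf,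
    fun q hq => ?_, fun q hq => ?_⟩
  · rw [hmem q hq, PiLp.ext_iff]
    rfl
  · exact (PiLp.continuousLinearEquiv 2 ℝ fun _ : ι => ℝ).symm.hasFDerivAt.comp q
      (hasFDerivAt_pi.2 (hf' q hq))

theorem isEmbeddedSubmanifold [Fintype ι] (h : IsOrthogonalLevelSet S w) {d : ℕ}
    (hd : Fintype.card ι + d = Module.finrank ℝ V) : IsEmbeddedSubmanifold S d := by
  have h' := h.reindex (Fintype.equivFin ι).symm
  obtain ⟨U, hU, hSU, f, hf, hmem, hf'⟩ := h'.exists_submersion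
  refine ⟨_, hd, fun p hp => ⟨U, hU, hSU hp, f, hf, hmem, fun q hq => ?_⟩⟩
  rw [(hf' q hq.1).fderiv]
  exact innerCoordinates_surjective (h'.ne_zero q hq.1) (h'.pairwise_inner q hq.1)

variable [FiniteDimensional ℝ V]

theorem mem_tangentSpaceAt_iff [Finite ι] (h : IsOrthogonalLevelSet S w) (hp : p ∈ S) {X : V} :
    X ∈ tangentSpaceAt S p ↔ ∀ i, ⟪w i p, X⟫ = 0 := by
  cases nonempty_fintype ι
  obtain ⟨U, hU, hSU, f, hf, hmem, hf'⟩ := h.exists_submersion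
  have hUp : U ∈ 𝓝 p := hU.mem_nhds (hSU hp)
  rw [tangentSpaceAt_eq_ker (hf.contDiffAt hUp) (hf' p hp)
    (innerCoordinates_surjective (h.ne_zero p hp) (h.pairwise_inner p hp)) hp
    (Filter.eventually_of_mem hUp hmem), LinearMap.mem_ker, PiLp.ext_iff]
  rfl

theorem starProjection_tangentSpaceAt [Fintype ι] (h : IsOrthogonalLevelSet S w) (hp : p ∈ S)
    (v : V) :
    (tangentSpaceAt S p).starProjection v =
      v - ∑ i, (⟪w i p, v⟫ / ⟪w i p, w i p⟫) • w i p :=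
  starProjection_eq_sub_sum (h.ne_zero p hp) (h.pairwise_inner p hp)
    (fun _ => h.mem_tangentSpaceAt_iff hp) v

end IsOrthogonalLevelSet

section Hypersurfaces

theorem IsEmbeddedHypersurface.isProperlyEmbeddedHypersurface {V : Type*} [NormedAddCommGroup V]
    [InnerProductSpace ℝ V] [FiniteDimensional ℝ V] {P S : Set V}
    (h : IsEmbeddedHypersurface P S) (hS : IsClosed S) : IsProperlyEmbeddedHypersurface P S :=
  ⟨h, h.1,
    (Topology.IsClosedEmbedding.inclusion h.1 (hS.preimage continuous_subtype_val)).isProperMap⟩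

variable {ι V : Type*} [NormedAddCommGroup V] [InnerProductSpace ℝ V]
  {P S : Set V} {w : ι → V → V} {g : V → V} {p : V}

/-- `S` is a hypersurface of the level set `P`, obtained by imposing one further equation, whose
gradient along `S` is `g`. It is used to compute the geometry of `S` in `P` from `g` and the
gradients `w i` of the equations of `P`; the gradients of the equations of `S` are indexed by
`Option ι`. -/
structure IsLevelHypersurface (P S : Set V) (w : ι → V → V) (g : V → V) : Prop where
  ambient : IsOrthogonalLevelSet P w
  subset : S ⊆ P
  levelSet : IsOrthogonalLevelSet S (Option.elim' g w)

theorem IsOrthogonalLevelSet.isLevelHypersurface (h : IsOrthogonalLevelSet P w) (hSP : S ⊆ P)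
    {U : Set V} (hU : IsOpen U) {f : V → ℝ} (hf : ContDiffOn ℝ ∞ f U)
    (hS : ∀ q ∈ P, q ∈ S ↔ q ∈ U ∧ f q = 0)
    (hg : ∀ q ∈ S, HasFDerivAt f (innerSL ℝ (g q)) q) (hg0 : ∀ q ∈ S, g q ≠ 0)
    (hgw : ∀ q ∈ S, ∀ i, ⟪g q, w i q⟫ = 0) : IsLevelHypersurface P S w g where
  ambient := h
  subset := hSP
  levelSet :=
    { exists_equations := by
        obtain ⟨U', hU', hPU', f', hf', hmem, hw⟩ := h.exists_equations
        refine ⟨U ∩ U', hU.inter hU', fun q hq => ⟨((hS q (hSP hq)).1 hq).1, hPU' (hSP hq)⟩,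
          Option.elim' f f', Option.forall.2 ⟨hf.mono Set.inter_subset_left,
            fun i => (hf' i).mono Set.inter_subset_right⟩, fun q hq => ?_,
          fun q hq => Option.forall.2 ⟨hg q hq, hw q (hSP hq)⟩⟩
        rw [Option.forall]
        change q ∈ S ↔ f q = 0 ∧ ∀ i, f' i q = 0
        rw [← hmem q hq.2]
        exact ⟨fun h => ⟨((hS q (hSP h)).1 h).2, hSP h⟩, fun h => (hS q h.2).2 ⟨hq.1, h.1⟩⟩
      ne_zero := fun q hq => Option.forall.2 ⟨hg0 q hq, h.ne_zero q (hSP hq)⟩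
      pairwise_inner := by
        rintro q hq (_ | i) (_ | j) hij
        · exact absurd rfl hij
        · exact hgw q hq j
        · exact (real_inner_comm _ _).trans (hgw q hq i)
        · exact h.pairwise_inner q (hSP hq) fun hij' => hij (congrArg some hij') }

namespace IsLevelHypersurface

theorem ne_zero (h : IsLevelHypersurface P S w g) (hp : p ∈ S) : g p ≠ 0 :=
  h.levelSet.ne_zero p hp none

theorem inner_eq_zero (h : IsLevelHypersurface P S w g) (hp : p ∈ S) (i : ι) :
    ⟪g p, w i p⟫ = 0 :=
  h.levelSet.pairwise_inner p hp (Option.some_ne_none i).symm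

theorem inter (h : IsLevelHypersurface P S w g) {W : Set V} (hW : IsOpen W) :
    IsLevelHypersurface P (S ∩ W) w g where
  ambient := h.ambient
  subset := Set.inter_subset_left.trans h.subset
  levelSet := h.levelSet.inter hW

theorem isEmbeddedHypersurface [Fintype ι] (h : IsLevelHypersurface P S w g)
    (hι : Fintype.card ι < Module.finrank ℝ V) : IsEmbeddedHypersurface P S := by
  obtain ⟨d, hd⟩ := Nat.exists_eq_add_of_lt hι
  refine ⟨h.subset, d, h.ambient.isEmbeddedSubmanifold (by omega),
    h.levelSet.isEmbeddedSubmanifold ?_⟩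
  rw [Fintype.card_option]
  omega

variable [Finite ι] [FiniteDimensional ℝ V]

theorem mem_tangentSpaceAt_iff (h : IsLevelHypersurface P S w g) (hp : p ∈ S) {X : V} :
    X ∈ tangentSpaceAt S p ↔ ⟪g p, X⟫ = 0 ∧ ∀ i, ⟪w i p, X⟫ = 0 :=
  (h.levelSet.mem_tangentSpaceAt_iff hp).trans Option.forall

theorem tangentSpaceAt_le (h : IsLevelHypersurface P S w g) (hp : p ∈ S) :
    tangentSpaceAt S p ≤ tangentSpaceAt P p := fun _ hX =>
  (h.ambient.mem_tangentSpaceAt_iff (h.subset hp)).2 ((h.mem_tangentSpaceAt_iff hp).1 hX).2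

theorem starProjection_tangentSpaceAt (h : IsLevelHypersurface P S w g) (hp : p ∈ S) {v : V}
    (hv : ∀ i, ⟪w i p, v⟫ = 0) :
    (tangentSpaceAt S p).starProjection v = v - (⟪g p, v⟫ / ⟪g p, g p⟫) • g p := by
  cases nonempty_fintype ι
  rw [h.levelSet.starProjection_tangentSpaceAt hp, Fintype.sum_option]
  simp [hv]

theorem eq_smul_of_inner_eq_zero (h : IsLevelHypersurface P S w g) (hp : p ∈ S) {v : V}
    (hv : ∀ i, ⟪w i p, v⟫ = 0) (hvS : ∀ X ∈ tangentSpaceAt S p, ⟪X, v⟫ = 0) :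
    v = (⟪g p, v⟫ / ⟪g p, g p⟫) • g p := by
  have hv0 : (tangentSpaceAt S p).starProjection v = 0 :=
    (Submodule.starProjection_apply_eq_zero_iff _).2 ((Submodule.mem_orthogonal _ _).2 hvS)
  rwa [h.starProjection_tangentSpaceAt hp hv, sub_eq_zero] at hv0

end IsLevelHypersurface

section ShapeOperator

variable [FiniteDimensional ℝ V] {N : V → V}

theorem shapeOperator_eq_of_le (hle : tangentSpaceAt S p ≤ tangentSpaceAt P p) :
    shapeOperator P S N p = -((tangentSpaceAt S p).orthogonalProjectionOnto.toLinearMap ∘ₗ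
      (fderiv ℝ N p).toLinearMap ∘ₗ (tangentSpaceAt S p).subtype) := by
  ext X
  simp [shapeOperator, covariantDerivative,
    Submodule.orthogonalProjectionOnto_starProjection_of_le hle]

theorem inner_shapeOperator (hle : tangentSpaceAt S p ≤ tangentSpaceAt P p)
    (X Y : tangentSpaceAt S p) : ⟪shapeOperator P S N p X, Y⟫ = -⟪fderiv ℝ N p X, (Y : V)⟫ := by
  rw [shapeOperator_eq_of_le hle]
  simp [inner_neg_left]

theorem IsLevelHypersurface.trace_shapeOperator [Fintype ι] (h : IsLevelHypersurface P S w g)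
    (hp : p ∈ S) {L : V →ₗ[ℝ] V} (hL : Set.EqOn (fderiv ℝ N p) L (tangentSpaceAt S p)) :
    LinearMap.trace ℝ (tangentSpaceAt S p) (shapeOperator P S N p) =
      -(LinearMap.trace ℝ V L - ⟪L (g p), g p⟫ / ⟪g p, g p⟫ -
        ∑ i, ⟪L (w i p), w i p⟫ / ⟪w i p, w i p⟫) := by
  have hfderiv : (fderiv ℝ N p).toLinearMap ∘ₗ (tangentSpaceAt S p).subtype =
      L ∘ₗ (tangentSpaceAt S p).subtype := LinearMap.ext fun X => hL X.2
  rw [shapeOperator_eq_of_le (h.tangentSpaceAt_le hp), hfderiv, map_neg,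
    trace_orthogonalProjectionOnto_comp (h.levelSet.ne_zero p hp) (h.levelSet.pairwise_inner p hp)
      fun _ => h.levelSet.mem_tangentSpaceAt_iff hp, Fintype.sum_option, sub_sub]
  rfl

end ShapeOperator

/-- `R` is the reflection in a linear subspace. Such maps encode the Lorentzian metric, as
`⟪·, R ·⟫`, and the quadratic forms defining the hypersurfaces under study. -/
structure IsOrthogonalReflection (R : V →L[ℝ] V) : Prop where
  inner_apply_left : ∀ x y, ⟪R x, y⟫ = ⟪x, R y⟫
  involutive : Function.Involutive R

namespace IsOrthogonalReflection

variable {R : V →L[ℝ] V}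

theorem id : IsOrthogonalReflection (ContinuousLinearMap.id ℝ V) where
  inner_apply_left _ _ := rfl
  involutive _ := rfl

theorem inner_apply_apply (hR : IsOrthogonalReflection R) (x y : V) : ⟪R x, R y⟫ = ⟪x, y⟫ := by
  rw [hR.inner_apply_left, hR.involutive]

theorem norm_apply (hR : IsOrthogonalReflection R) (x : V) : ‖R x‖ = ‖x‖ := by
  rw [norm_eq_sqrt_real_inner, hR.inner_apply_apply, norm_eq_sqrt_real_inner]

end IsOrthogonalReflection

/-- `N` is a smooth unit normal field of the hypersurface `S` of `P` with respect to the bilinear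
form `⟪·, R ·⟫`, with `⟪N, R N⟫ = ε`. It treats Riemannian unit normals (`R = id`, `ε = 1`) and
Lorentzian ones (`ε = -1`) at once. -/
structure IsPseudoUnitNormalField (P S : Set V) (R : V →L[ℝ] V) (ε : ℝ) (N : V → V) : Prop where
  isSmoothFieldAlong : IsSmoothFieldAlong P S N
  inner_self : ∀ p ∈ S, ⟪N p, R (N p)⟫ = ε
  inner_tangent : ∀ p ∈ S, ∀ X ∈ tangentSpaceAt S p, ⟪X, R (N p)⟫ = 0

theorem isPseudoUnitNormalField_id_iff {N : V → V} :
    IsPseudoUnitNormalField P S (ContinuousLinearMap.id ℝ V) 1 N ↔ IsUnitNormalField P S N := by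
  have hnorm (p : V) : ⟪N p, N p⟫ = 1 ↔ ‖N p‖ = 1 := by
    rw [real_inner_self_eq_norm_sq, pow_eq_one_iff_of_nonneg (norm_nonneg _) two_ne_zero]
  exact ⟨fun h => ⟨h.1, fun p hp => ⟨(hnorm p).1 (h.2 p hp), h.3 p hp⟩⟩,
    fun h => ⟨h.1, fun p hp => (hnorm p).2 (h.2 p hp).1, fun p hp => (h.2 p hp).2⟩⟩

theorem IsSmoothFieldAlong.differentiableAt {N : V → V} (hN : IsSmoothFieldAlong P S N)
    (hp : p ∈ S) : DifferentiableAt ℝ N p := by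
  obtain ⟨⟨U, hU, hSU, hNU⟩, -⟩ := hN
  exact (hNU.contDiffAt (hU.mem_nhds (hSU hp))).differentiableAt (by simp)

/-- The factor `b` in `N = b • R g`, for a vector `N` whose image under the reflection `R` is a
multiple of `g`. -/
noncomputable def normalCoefficient (R : V →L[ℝ] V) (g N : V → V) (q : V) : ℝ :=
  ⟪g q, R (N q)⟫ / ⟪g q, g q⟫

theorem differentiableAt_normalCoefficient {R : V →L[ℝ] V} {N : V → V}
    (hg : DifferentiableAt ℝ g p) (hN : DifferentiableAt ℝ N p) (hg0 : g p ≠ 0) :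
    DifferentiableAt ℝ (normalCoefficient R g N) p := by
  have hgN : DifferentiableAt ℝ (fun q => ⟪g q, R (N q)⟫) p :=
    hg.inner ℝ (R.differentiableAt.comp p hN)
  have hgg : DifferentiableAt ℝ (fun q => ⟪g q, g q⟫) p := hg.inner ℝ hg
  exact (hgN.fun_mul (hgg.fun_inv (inner_self_ne_zero.2 hg0))).congr_of_eventuallyEq
    (.of_forall fun q => div_eq_mul_inv _ _)

namespace IsPseudoUnitNormalField

variable [FiniteDimensional ℝ V] {R : V →L[ℝ] V} {ε : ℝ} {N : V → V}
  (hN : IsPseudoUnitNormalField P S R ε N) (h : IsLevelHypersurface P S w g)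
  (hR : IsOrthogonalReflection R) (hRw : ∀ q ∈ S, ∀ i, R (w i q) = w i q)

include hN h hR hRw

section

variable [Finite ι]

theorem map_eq_smul (hp : p ∈ S) : R (N p) = normalCoefficient R g N p • g p := by
  refine h.eq_smul_of_inner_eq_zero hp (fun i => ?_) (hN.inner_tangent p hp)
  rw [← hR.inner_apply_left, hRw p hp]
  exact (h.ambient.mem_tangentSpaceAt_iff (h.subset hp)).1 (hN.isSmoothFieldAlong.2 p hp) i

theorem eq_smul (hp : p ∈ S) : N p = normalCoefficient R g N p • R (g p) := by
  rw [← map_smul, ← hN.map_eq_smul h hR hRw hp, hR.involutive]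

theorem normalCoefficient_mul_mul (hp : p ∈ S) :
    normalCoefficient R g N p * (normalCoefficient R g N p * ⟪R (g p), g p⟫) = ε := by
  rw [← real_inner_smul_right, ← real_inner_smul_left, ← hN.eq_smul h hR hRw hp,
    ← hN.map_eq_smul h hR hRw hp, hN.inner_self p hp]

theorem normalCoefficient_ne_zero (hε : ε ≠ 0) (hp : p ∈ S) : normalCoefficient R g N p ≠ 0 :=
  left_ne_zero_of_mul ((hN.normalCoefficient_mul_mul h hR hRw hp).trans_ne hε)

theorem inner_map_gradient_ne_zero (hε : ε ≠ 0) (hp : p ∈ S) : ⟪R (g p), g p⟫ ≠ 0 :=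
  right_ne_zero_of_mul (right_ne_zero_of_mul
    ((hN.normalCoefficient_mul_mul h hR hRw hp).trans_ne hε))

theorem inner_fderiv_gradient (hε : ε ≠ 0) (hp : p ∈ S) {X : V}
    (hX : X ∈ tangentSpaceAt S p) : ⟪fderiv ℝ N p X, g p⟫ = 0 := by
  have hNd := (hN.isSmoothFieldAlong.differentiableAt hp).hasFDerivAt
  have hNN := hNd.inner ℝ (R.hasFDerivAt.comp p hNd)
  have hconst := fderiv_eqOn_tangentSpaceAt hNN.differentiableAt (differentiableAt_const ε)
    (fun q hq => hN.inner_self q hq) hX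
  have htwice : 2 * ⟪fderiv ℝ N p X, R (N p)⟫ = 0 := by
    rw [hNN.fderiv] at hconst
    simp only [ContinuousLinearMap.comp_apply, ContinuousLinearMap.prod_apply,
      fderivInnerCLM_apply, Function.comp_apply, fderiv_fun_const, Pi.zero_apply,
      zero_apply] at hconst
    rw [← hR.inner_apply_left, real_inner_comm] at hconst
    linarith
  rw [hN.map_eq_smul h hR hRw hp, real_inner_smul_right] at htwice
  simpa [hN.normalCoefficient_ne_zero h hR hRw hε hp] using htwice

theorem fderiv_apply_eq_smul_add (hp : p ∈ S) {D : V →L[ℝ] V}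
    (hD : HasFDerivAt g D p) {X : V} (hX : X ∈ tangentSpaceAt S p) :
    fderiv ℝ N p X = fderiv ℝ (normalCoefficient R g N) p X • R (g p) +
      normalCoefficient R g N p • R (D X) := by
  have hNd := hN.isSmoothFieldAlong.differentiableAt hp
  have hbg := (differentiableAt_normalCoefficient (R := R) hD.differentiableAt hNd
    (h.ne_zero hp)).hasFDerivAt.smul (R.hasFDerivAt.comp p hD)
  rw [fderiv_eqOn_tangentSpaceAt hNd hbg.differentiableAt
    (fun q hq => hN.eq_smul h hR hRw hq) hX, hbg.fderiv]
  simp [add_comm]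

theorem fderiv_apply (hε : ε ≠ 0) (hp : p ∈ S) {D : V →L[ℝ] V}
    (hD : HasFDerivAt g D p) {X : V} (hX : X ∈ tangentSpaceAt S p) :
    fderiv ℝ N p X = normalCoefficient R g N p •
      (R (D X) - (⟪R (D X), g p⟫ / ⟪R (g p), g p⟫) • R (g p)) := by
  have hRgg := hN.inner_map_gradient_ne_zero h hR hRw hε hp
  have hfderiv := hN.fderiv_apply_eq_smul_add h hR hRw hp hD hX
  have hort := hN.inner_fderiv_gradient h hR hRw hε hp hX
  rw [hfderiv, inner_add_left, real_inner_smul_left, real_inner_smul_left] at hort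
  rw [hfderiv, (eq_div_iff hRgg).2 (eq_neg_of_add_eq_zero_left hort)]
  module

theorem inner_fderiv_apply (hε : ε ≠ 0) (hp : p ∈ S) {D : V →L[ℝ] V}
    (hD : HasFDerivAt g D p) {X Y : V} (hX : X ∈ tangentSpaceAt S p)
    (hY : Y ∈ tangentSpaceAt S p) :
    ⟪fderiv ℝ N p X, R Y⟫ = normalCoefficient R g N p * ⟪D X, Y⟫ := by
  rw [hN.fderiv_apply h hR hRw hε hp hD hX, real_inner_smul_left, inner_sub_left,
    real_inner_smul_left, hR.inner_apply_apply, hR.inner_apply_apply,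
    ((h.mem_tangentSpaceAt_iff hp).1 hY).1, mul_zero, sub_zero]

end

theorem trace_shapeOperator [Fintype ι] (hε : ε ≠ 0) (hp : p ∈ S) {D : V →L[ℝ] V}
    (hD : HasFDerivAt g D p) :
    LinearMap.trace ℝ (tangentSpaceAt S p) (shapeOperator P S N p) =
      -(normalCoefficient R g N p * (LinearMap.trace ℝ V (R ∘L D).toLinearMap -
        ⟪D (R (g p)), R (g p)⟫ / ⟪R (g p), g p⟫ -
          ∑ i, ⟪D (w i p), w i p⟫ / ⟪w i p, w i p⟫)) := by
  have hRgg := hN.inner_map_gradient_ne_zero h hR hRw hε hp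
  let L : V →ₗ[ℝ] V := normalCoefficient R g N p • ((R ∘L D).toLinearMap -
    (innerSL ℝ (g p) ∘L R ∘L D).toLinearMap.smulRight (⟪R (g p), g p⟫⁻¹ • R (g p)))
  have hL (X : V) : L X = normalCoefficient R g N p •
      (R (D X) - (⟪R (D X), g p⟫ / ⟪R (g p), g p⟫) • R (g p)) := by
    simp [L, smul_smul, div_eq_mul_inv, real_inner_comm]
  have hLg : ⟪L (g p), g p⟫ = 0 := by
    rw [hL, real_inner_smul_left, inner_sub_left, real_inner_smul_left,
      div_mul_cancel₀ _ hRgg, sub_self, mul_zero]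
  have hLw (i : ι) : ⟪L (w i p), w i p⟫ = normalCoefficient R g N p * ⟪D (w i p), w i p⟫ := by
    rw [hL, real_inner_smul_left, inner_sub_left, real_inner_smul_left, hR.inner_apply_left (D _),
      hR.inner_apply_left (g p) (w i p), hRw p hp, h.inner_eq_zero hp, mul_zero, sub_zero]
  have hLtr : LinearMap.trace ℝ V L = normalCoefficient R g N p *
      (LinearMap.trace ℝ V (R ∘L D).toLinearMap -
        ⟪D (R (g p)), R (g p)⟫ / ⟪R (g p), g p⟫) := by
    have hgD : ⟪g p, R (D (R (g p)))⟫ = ⟪D (R (g p)), R (g p)⟫ := by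
      rw [real_inner_comm, hR.inner_apply_left]
    simp [L, LinearMap.trace_smulRight, hgD, div_eq_inv_mul]
  rw [h.trace_shapeOperator hp fun X hX =>
    (hN.fderiv_apply h hR hRw hε hp hD hX).trans (hL X).symm, hLg, hLtr]
  simp only [hLw, mul_div_assoc, ← Finset.mul_sum]
  ring

theorem trace_shapeOperator_eq_zero [Finite ι] (hε : ε ≠ 0) (hp : p ∈ S) {D : V →L[ℝ] V}
    (hD : HasFDerivAt g D p) (htrace : LinearMap.trace ℝ V (R ∘L D).toLinearMap = 0)
    (hg : ⟪D (R (g p)), R (g p)⟫ = 0) (hw : ∀ i, ⟪D (w i p), w i p⟫ = 0) :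
    LinearMap.trace ℝ (tangentSpaceAt S p) (shapeOperator P S N p) = 0 := by
  cases nonempty_fintype ι
  rw [hN.trace_shapeOperator h hR hRw hε hp hD, htrace, hg]
  simp [hw]

end IsPseudoUnitNormalField

namespace IsLevelHypersurface

variable [Finite ι] [FiniteDimensional ℝ V]

theorem exists_isPseudoUnitNormalField (h : IsLevelHypersurface P S w g) (hg : ContDiff ℝ ∞ g)
    {R : V →L[ℝ] V} (hR : IsOrthogonalReflection R) (hRw : ∀ q ∈ S, ∀ i, R (w i q) = w i q) {ε : ℝ}
    (hε : ∀ q ∈ S, 0 < ε / ⟪g q, R (g q)⟫) :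
    ∃ N, IsPseudoUnitNormalField P S R ε N := by
  have hgR : ContDiff ℝ ∞ fun q => ⟪g q, R (g q)⟫ := hg.inner ℝ (R.contDiff.comp hg)
  have hgR0 (q : V) (hq : 0 < ε / ⟪g q, R (g q)⟫) : ⟪g q, R (g q)⟫ ≠ 0 := fun h0 => by
    simp [h0] at hq
  let U := {q | ⟪g q, R (g q)⟫ ≠ 0}
  have hU : IsOpen U := isOpen_ne_fun hgR.continuous continuous_const
  have hquot : ContDiffOn ℝ ∞ (fun q => ε / ⟪g q, R (g q)⟫) U :=
    contDiffOn_const.div hgR.contDiffOn fun q hq => hq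
  refine ⟨fun q => √(ε / ⟪g q, R (g q)⟫) • R (g q), ⟨⟨_,
    hquot.continuousOn.isOpen_inter_preimage hU isOpen_Ioi, fun q hq => ⟨hgR0 q (hε q hq), hε q hq⟩,
    ((hquot.mono Set.inter_subset_left).sqrt fun q hq => ne_of_gt hq.2).smul
      (R.contDiff.comp hg).contDiffOn⟩, fun q hq => ?_⟩, fun q hq => ?_, fun q hq X hX => ?_⟩
  · refine (h.ambient.mem_tangentSpaceAt_iff (h.subset hq)).2 fun i => ?_
    rw [inner_smul_right, ← hR.inner_apply_left (w i q), hRw q hq, real_inner_comm (g q) (w i q),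
      h.inner_eq_zero hq, mul_zero]
  · rw [map_smul, hR.involutive, real_inner_smul_left, real_inner_smul_right,
      real_inner_comm (g q), ← mul_assoc, Real.mul_self_sqrt (hε q hq).le,
      div_mul_cancel₀ _ (hgR0 q (hε q hq))]
  · rw [map_smul, hR.involutive, inner_smul_right, real_inner_comm (g q) X,
      ((h.mem_tangentSpaceAt_iff hq).1 hX).1, mul_zero]

theorem exists_isUnitNormalField (h : IsLevelHypersurface P S w g) (hg : ContDiff ℝ ∞ g) :
    ∃ N, IsUnitNormalField P S N := by
  obtain ⟨N, hN⟩ := h.exists_isPseudoUnitNormalField hg .id (fun _ _ _ => rfl) (ε := 1)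
    fun q hq => one_div_pos.2 (real_inner_self_pos.2 (h.ne_zero hq))
  exact ⟨N, isPseudoUnitNormalField_id_iff.1 hN⟩

theorem meanCurvature_eq_zero (h : IsLevelHypersurface P S w g) {N : V → V}
    (hN : IsUnitNormalField P S N) (hp : p ∈ S) {D : V →L[ℝ] V} (hD : HasFDerivAt g D p)
    (htrace : LinearMap.trace ℝ V D.toLinearMap = 0) (hg : ⟪D (g p), g p⟫ = 0)
    (hw : ∀ i, ⟪D (w i p), w i p⟫ = 0) : meanCurvature P S N p = 0 :=
  (isPseudoUnitNormalField_id_iff.2 hN).trace_shapeOperator_eq_zero h .id (fun _ _ _ => rfl)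
    one_ne_zero hp hD (by rwa [ContinuousLinearMap.id_comp]) hg hw

end IsLevelHypersurface

end Hypersurfaces

section ProductWithLine

theorem withLp_prod_ext {E : Type*} {X Y : WithLp 2 (E × ℝ)} (hfst : X.fst = Y.fst)
    (hsnd : X.snd = Y.snd) : X = Y :=
  WithLp.ofLp_injective 2 (Prod.ext hfst hsnd)

variable {E : Type*} [NormedAddCommGroup E] [InnerProductSpace ℝ E]

theorem inner_withLp_prod (X Y : WithLp 2 (E × ℝ)) :
    ⟪X, Y⟫ = ⟪X.fst, Y.fst⟫ + X.snd * Y.snd := by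
  rw [WithLp.prod_inner_apply, real_inner_comm Y.ofLp.snd]
  rfl

theorem inner_verticalVector (X : WithLp 2 (E × ℝ)) : ⟪X, verticalVector⟫ = X.snd := by
  simp [verticalVector]

theorem finrank_withLp_prod [FiniteDimensional ℝ E] :
    Module.finrank ℝ (WithLp 2 (E × ℝ)) = Module.finrank ℝ E + 1 := by
  rw [(WithLp.linearEquiv 2 ℝ (E × ℝ)).finrank_eq, Module.finrank_prod, Module.finrank_self]

theorem trace_withLp_prod [FiniteDimensional ℝ E] (L : WithLp 2 (E × ℝ) →ₗ[ℝ] WithLp 2 (E × ℝ))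
    {A : E →ₗ[ℝ] E} (hA : ∀ v, (L (WithLp.toLp 2 (v, 0))).fst = A v) :
    LinearMap.trace ℝ _ L = LinearMap.trace ℝ E A + (L verticalVector).snd := by
  rw [LinearMap.trace_eq_sum_inner L
    ((stdOrthonormalBasis ℝ E).prod (OrthonormalBasis.singleton Unit ℝ)),
    LinearMap.trace_eq_sum_inner A (stdOrthonormalBasis ℝ E)]
  simp [hA, verticalVector]

/-- The reflection `(x, t) ↦ (x, -t)`, which turns the Riemannian product metric into the
Lorentzian one. -/
noncomputable def heightReflection : WithLp 2 (E × ℝ) →L[ℝ] WithLp 2 (E × ℝ) :=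
  (WithLp.prodContinuousLinearEquiv 2 ℝ E ℝ).symm.toContinuousLinearMap ∘L
    (WithLp.fstL 2 ℝ E ℝ).prod (-WithLp.sndL 2 ℝ E ℝ)

theorem heightReflection_apply (X : WithLp 2 (E × ℝ)) :
    heightReflection X = WithLp.toLp 2 (X.fst, -X.snd) := rfl

theorem lorentzForm_eq_inner (X Y : WithLp 2 (E × ℝ)) :
    lorentzForm X Y = ⟪X, heightReflection Y⟫ := by
  rw [inner_withLp_prod, lorentzForm, sub_eq_add_neg, ← mul_neg]
  rfl

theorem isOrthogonalReflection_heightReflection :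
    IsOrthogonalReflection (heightReflection : WithLp 2 (E × ℝ) →L[ℝ] WithLp 2 (E × ℝ)) where
  inner_apply_left X Y := by
    rw [inner_withLp_prod, inner_withLp_prod]
    simp [heightReflection_apply]
  involutive X := withLp_prod_ext rfl (neg_neg X.snd)

theorem lorentzForm_pos_of_inner_eq_zero {g X : WithLp 2 (E × ℝ)} (hg : lorentzForm g g < 0)
    (hgX : ⟪g, X⟫ = 0) (hX : X ≠ 0) : 0 < lorentzForm X X := by
  have hg' : ⟪g.fst, g.fst⟫ < g.snd * g.snd := sub_neg.1 hg
  have hgsnd : 0 < g.snd * g.snd := real_inner_self_nonneg.trans_lt hg'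
  rw [inner_withLp_prod] at hgX
  have hfst : X.fst ≠ 0 := fun hfst => hX <| withLp_prod_ext hfst <| by
    simpa [hfst, left_ne_zero_of_mul hgsnd.ne'] using hgX
  have hcauchy := real_inner_mul_inner_self_le g.fst X.fst
  rw [eq_neg_of_add_eq_zero_left hgX] at hcauchy
  refine sub_pos.2 (lt_of_mul_lt_mul_left ?_ hgsnd.le)
  calc g.snd * g.snd * (X.snd * X.snd) = -(g.snd * X.snd) * -(g.snd * X.snd) := by ring
    _ ≤ ⟪g.fst, g.fst⟫ * ⟪X.fst, X.fst⟫ := hcauchy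
    _ < g.snd * g.snd * ⟪X.fst, X.fst⟫ :=
        mul_lt_mul_of_pos_right hg' (real_inner_self_pos.2 hfst)

variable {ι : Type*} {M : Set E} {y : ι → E → E}

/-- The horizontal fields on `E × ℝ` given by vector fields on `E`: the gradients of the equations
of `M`, viewed as equations of `M × ℝ`. -/
def horizontalLift (y : ι → E → E) (i : ι) (p : WithLp 2 (E × ℝ)) : WithLp 2 (E × ℝ) :=
  WithLp.toLp 2 (y i p.fst, 0)

theorem inner_horizontalLift (X p : WithLp 2 (E × ℝ)) (i : ι) :
    ⟪X, horizontalLift y i p⟫ = ⟪X.fst, y i p.fst⟫ := by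
  simp [horizontalLift]

theorem heightReflection_horizontalLift (i : ι) (p : WithLp 2 (E × ℝ)) :
    heightReflection (horizontalLift y i p) = horizontalLift y i p :=
  withLp_prod_ext rfl neg_zero

namespace IsOrthogonalLevelSet

theorem cylinder (hM : IsOrthogonalLevelSet M y) :
    IsOrthogonalLevelSet (cylinder M) (horizontalLift y) where
  exists_equations := by
    obtain ⟨U, hU, hMU, f, hf, hmem, hf'⟩ := hM.exists_equations
    refine ⟨{p | p.fst ∈ U}, hU.preimage (WithLp.fstL 2 ℝ E ℝ).continuous, fun p hp => hMU hp,
      fun i p => f i p.fst, fun i => (hf i).comp (WithLp.fstL 2 ℝ E ℝ).contDiff.contDiffOn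
        fun _ hp => hp, fun p hp => hmem p.fst hp, fun p hp i => ?_⟩
    refine ((hf' p.fst hp i).comp p (WithLp.fstL 2 ℝ E ℝ).hasFDerivAt).congr_fderiv ?_
    refine ContinuousLinearMap.ext fun X => ?_
    rw [innerSL_apply_apply, real_inner_comm X, inner_horizontalLift, real_inner_comm]
    rfl
  ne_zero p hp i h0 := hM.ne_zero p.fst hp i (congrArg WithLp.fst h0)
  pairwise_inner p hp i j hij :=
    (inner_horizontalLift _ _ _).trans (hM.pairwise_inner p.fst hp hij)

theorem horizontalSlice (hM : IsOrthogonalLevelSet M y) (t : ℝ) :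
    IsOrthogonalLevelSet (horizontalSlice M t)
      (Option.elim' (fun _ => verticalVector) (horizontalLift y)) := by
  refine (hM.cylinder.isLevelHypersurface (fun p hp => hp.1) isOpen_univ
    (f := fun p => p.snd - t) ((WithLp.sndL 2 ℝ E ℝ).contDiff.sub contDiff_const).contDiffOn
    (fun p hp => ?_) (fun p _ => ?_) (fun p _ h0 => ?_) fun p _ i => ?_).levelSet
  · simp only [Set.mem_univ, true_and, sub_eq_zero]
    exact and_iff_right hp
  · refine ((WithLp.sndL 2 ℝ E ℝ).hasFDerivAt.sub_const t).congr_fderiv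
      (ContinuousLinearMap.ext fun X => ?_)
    rw [innerSL_apply_apply, real_inner_comm, inner_verticalVector]
    rfl
  · exact one_ne_zero (congrArg WithLp.snd h0)
  · rw [inner_horizontalLift]
    exact inner_zero_left _

end IsOrthogonalLevelSet

variable {S : Set (WithLp 2 (E × ℝ))} {g N : WithLp 2 (E × ℝ) → WithLp 2 (E × ℝ)}
  {p : WithLp 2 (E × ℝ)}

theorem isPseudoUnitNormalField_heightReflection_iff :
    IsPseudoUnitNormalField (cylinder M) S heightReflection (-1) N ↔
      IsLorentzUnitNormalField M S N := by
  simp only [IsLorentzUnitNormalField, lorentzForm_eq_inner]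
  exact ⟨fun h => ⟨h.1, fun p hp => ⟨h.2 p hp, h.3 p hp⟩⟩,
    fun h => ⟨h.1, fun p hp => (h.2 p hp).1, fun p hp => (h.2 p hp).2⟩⟩

namespace IsLevelHypersurface

variable [FiniteDimensional ℝ E] [Finite ι]
  (h : IsLevelHypersurface (cylinder M) S (horizontalLift y) g)

include h

theorem coe_heightGradient (hp : p ∈ S) :
    (heightGradient S p : WithLp 2 (E × ℝ)) =
      verticalVector - ((g p).snd / ⟪g p, g p⟫) • g p := by
  rw [← inner_verticalVector (g p)]
  exact h.starProjection_tangentSpaceAt hp fun i => inner_verticalVector _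

theorem heightGradient_ne_zero (hp : p ∈ S) (hfst : (g p).fst ≠ 0) : heightGradient S p ≠ 0 := by
  intro h0
  have hvertical : verticalVector = ((g p).snd / ⟪g p, g p⟫) • g p := by
    rw [← sub_eq_zero, ← h.coe_heightGradient hp, h0, ZeroMemClass.coe_zero]
  have hcoeff : (g p).snd / ⟪g p, g p⟫ = 0 :=
    (smul_eq_zero.1 (congrArg WithLp.fst hvertical).symm).resolve_right hfst
  rw [hcoeff, zero_smul] at hvertical
  exact one_ne_zero (congrArg WithLp.snd hvertical)

theorem inner_shapeOperator_heightGradient (hN : IsUnitNormalField (cylinder M) S N)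
    (hp : p ∈ S) {D : WithLp 2 (E × ℝ) →L[ℝ] WithLp 2 (E × ℝ)} (hD : HasFDerivAt g D p) :
    ⟪shapeOperator (cylinder M) S N p (heightGradient S p), heightGradient S p⟫ =
      -(normalCoefficient (ContinuousLinearMap.id ℝ _) g N p *
        ⟪D (heightGradient S p), (heightGradient S p : WithLp 2 (E × ℝ))⟫) := by
  rw [inner_shapeOperator (h.tangentSpaceAt_le hp)]
  exact congrArg _ ((isPseudoUnitNormalField_id_iff.2 hN).inner_fderiv_apply h .id
    (fun _ _ _ => rfl) one_ne_zero hp hD (heightGradient S p).2 (heightGradient S p).2)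

theorem angleFunction_eq_zero_iff (hN : IsUnitNormalField (cylinder M) S N) (hp : p ∈ S) :
    angleFunction N p = 0 ↔ (g p).snd = 0 := by
  have hN' := isPseudoUnitNormalField_id_iff.2 hN
  rw [angleFunction, hN'.eq_smul h .id (fun _ _ _ => rfl) hp, real_inner_smul_left,
    inner_verticalVector, mul_eq_zero, or_iff_right
      (hN'.normalCoefficient_ne_zero h .id (fun _ _ _ => rfl) one_ne_zero hp)]
  rfl

theorem isSpacelike (hg : ∀ p ∈ S, lorentzForm (g p) (g p) < 0) : IsSpacelike S :=
  fun p hp _ hX => lorentzForm_pos_of_inner_eq_zero (hg p hp) ((h.mem_tangentSpaceAt_iff hp).1 hX).1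

theorem exists_isLorentzUnitNormalField (hg : ContDiff ℝ ∞ g)
    (htimelike : ∀ p ∈ S, lorentzForm (g p) (g p) < 0) :
    ∃ N, IsLorentzUnitNormalField M S N := by
  obtain ⟨N, hN⟩ := h.exists_isPseudoUnitNormalField hg isOrthogonalReflection_heightReflection
    (fun p _ i => heightReflection_horizontalLift i p) (ε := -1) fun p hp => by
      rw [← lorentzForm_eq_inner]
      exact div_pos_of_neg_of_neg neg_one_lt_zero (htimelike p hp)
  exact ⟨N, isPseudoUnitNormalField_heightReflection_iff.1 hN⟩

theorem lorentzMeanCurvature_eq_zero (hN : IsLorentzUnitNormalField M S N) (hp : p ∈ S)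
    {D : WithLp 2 (E × ℝ) →L[ℝ] WithLp 2 (E × ℝ)} (hD : HasFDerivAt g D p)
    (htrace : LinearMap.trace ℝ _ (heightReflection ∘L D).toLinearMap = 0)
    (hg : ⟪D (heightReflection (g p)), heightReflection (g p)⟫ = 0)
    (hy : ∀ i, ⟪D (horizontalLift y i p), horizontalLift y i p⟫ = 0) :
    lorentzMeanCurvature M S N p = 0 := by
  rw [lorentzMeanCurvature,
    (isPseudoUnitNormalField_heightReflection_iff.2 hN).trace_shapeOperator_eq_zero h
      isOrthogonalReflection_heightReflection (fun q _ i => heightReflection_horizontalLift i q)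
      (neg_ne_zero.2 one_ne_zero) hp hD htrace hg hy, neg_zero]

end IsLevelHypersurface

end ProductWithLine

section CliffordPairs

variable {E : Type*} [NormedAddCommGroup E] [InnerProductSpace ℝ E] {C T : E →L[ℝ] E}

/-- A pair of anticommuting orthogonal reflections: a Clifford system with two members. -/
structure IsCliffordPair (C T : E →L[ℝ] E) : Prop where
  left : IsOrthogonalReflection C
  right : IsOrthogonalReflection T
  anticomm : ∀ x, C (T x) = -T (C x)

namespace IsCliffordPair

theorem inner_left_right (h : IsCliffordPair C T) (x : E) : ⟪C x, T x⟫ = 0 := by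
  refine self_eq_neg.1 ?_
  calc ⟪C x, T x⟫ = ⟪x, C (T x)⟫ := h.left.inner_apply_left x (T x)
    _ = -⟪x, T (C x)⟫ := by rw [h.anticomm, inner_neg_right]
    _ = -⟪C x, T x⟫ := by rw [← h.right.inner_apply_left, real_inner_comm]

theorem trace_left [FiniteDimensional ℝ E] (h : IsCliffordPair C T) :
    LinearMap.trace ℝ E C.toLinearMap = 0 := by
  -- Conjugation by `T` preserves the trace of `C` and turns `C` into `-C`.
  have hleft : (C.toLinearMap ∘ₗ T.toLinearMap) ∘ₗ T.toLinearMap = C.toLinearMap :=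
    LinearMap.ext fun x => congrArg C (h.right.involutive x)
  have hright : T.toLinearMap ∘ₗ C.toLinearMap ∘ₗ T.toLinearMap = -C.toLinearMap :=
    LinearMap.ext fun x => by
      change T (C (T x)) = -C x
      rw [h.anticomm, map_neg, h.right.involutive]
  have hcomm := LinearMap.trace_comp_comm' (C.toLinearMap ∘ₗ T.toLinearMap) T.toLinearMap
  rw [hleft, hright, map_neg] at hcomm
  exact neg_eq_self.1 hcomm

end IsCliffordPair

/-- The reflection `cos φ C + sin φ T`, which interpolates between `C` and `T`. -/
noncomputable def rotatedReflection (C T : E →L[ℝ] E) (φ : ℝ) : E →L[ℝ] E :=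
  Real.cos φ • C + Real.sin φ • T

theorem rotatedReflection_apply (φ : ℝ) (x : E) :
    rotatedReflection C T φ x = Real.cos φ • C x + Real.sin φ • T x := rfl

theorem rotatedReflection_zero : rotatedReflection C T 0 = C := by
  simp [rotatedReflection]

theorem rotatedReflection_add_pi_div_two (φ : ℝ) :
    rotatedReflection C T (φ + Real.pi / 2) = -Real.sin φ • C + Real.cos φ • T := by
  rw [rotatedReflection, Real.cos_add_pi_div_two, Real.sin_add_pi_div_two]

theorem rotatedReflection_add_pi (φ : ℝ) :
    rotatedReflection C T (φ + Real.pi) = -rotatedReflection C T φ := by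
  simp only [rotatedReflection, Real.cos_add_pi, Real.sin_add_pi]
  module

theorem hasDerivAt_rotatedReflection (φ : ℝ) :
    HasDerivAt (rotatedReflection C T) (rotatedReflection C T (φ + Real.pi / 2)) φ := by
  rw [rotatedReflection_add_pi_div_two]
  exact ((Real.hasDerivAt_cos φ).smul_const C).add ((Real.hasDerivAt_sin φ).smul_const T)

theorem contDiff_rotatedReflection : ContDiff ℝ ∞ (rotatedReflection C T) :=
  (Real.contDiff_cos.smul contDiff_const).add (Real.contDiff_sin.smul contDiff_const)

namespace IsCliffordPair

theorem rotatedReflection_rotatedReflection (h : IsCliffordPair C T) (α β : ℝ) (x : E) :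
    rotatedReflection C T α (rotatedReflection C T β x) =
      rotatedReflection C T (α - β) (C x) := by
  simp only [rotatedReflection_apply, map_add, map_smul, h.left.involutive x,
    h.right.involutive x, h.anticomm, Real.cos_sub, Real.sin_sub]
  module

theorem isOrthogonalReflection_rotatedReflection (h : IsCliffordPair C T) (φ : ℝ) :
    IsOrthogonalReflection (rotatedReflection C T φ) where
  inner_apply_left x y := by
    simp only [rotatedReflection_apply, inner_add_left, inner_add_right, real_inner_smul_left,
      real_inner_smul_right, h.left.inner_apply_left, h.right.inner_apply_left]
  involutive x := by
    rw [h.rotatedReflection_rotatedReflection, sub_self, rotatedReflection_zero, h.left.involutive]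

theorem rotate (h : IsCliffordPair C T) (φ : ℝ) :
    IsCliffordPair (rotatedReflection C T φ) (rotatedReflection C T (φ + Real.pi / 2)) where
  left := h.isOrthogonalReflection_rotatedReflection φ
  right := h.isOrthogonalReflection_rotatedReflection (φ + Real.pi / 2)
  anticomm x := by
    rw [h.rotatedReflection_rotatedReflection, h.rotatedReflection_rotatedReflection,
      show φ + Real.pi / 2 - φ = φ - (φ + Real.pi / 2) + Real.pi by ring,
      rotatedReflection_add_pi, neg_apply, neg_neg]

end IsCliffordPair

end CliffordPairs

section TwistFunctions

variable {E : Type*} [NormedAddCommGroup E] [InnerProductSpace ℝ E] {C T : E →L[ℝ] E}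

/-- The function `(x, t) ↦ ½ ⟪A x, x⟫`, where the reflection `A` rotates at speed `m` from the
phase `φ` as the height `t` grows. Twistings are its zero sets. -/
noncomputable def twistFunction (C T : E →L[ℝ] E) (m φ : ℝ) (p : WithLp 2 (E × ℝ)) : ℝ :=
  1 / 2 * ⟪rotatedReflection C T (m * p.snd + φ) p.fst, p.fst⟫

/-- The gradient of `twistFunction`; its vertical part is `m` times the twist function whose phase
is a quarter turn ahead. -/
noncomputable def twistGradient (C T : E →L[ℝ] E) (m φ : ℝ) (p : WithLp 2 (E × ℝ)) :
    WithLp 2 (E × ℝ) :=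
  WithLp.toLp 2 (rotatedReflection C T (m * p.snd + φ) p.fst,
    m * twistFunction C T m (φ + Real.pi / 2) p)

/-- The derivative of `q ↦ A x`, where `q = (x, t)` and `A` rotates with `t`: the horizontal part
of the Hessian of `twistFunction`. -/
noncomputable def horizontalTwistHessian (C T : E →L[ℝ] E) (m φ : ℝ) (p : WithLp 2 (E × ℝ)) :
    WithLp 2 (E × ℝ) →L[ℝ] E :=
  rotatedReflection C T (m * p.snd + φ) ∘L WithLp.fstL 2 ℝ E ℝ +
    (m • WithLp.sndL 2 ℝ E ℝ).smulRight (rotatedReflection C T (m * p.snd + φ + Real.pi / 2) p.fst)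

/-- The Hessian of `twistFunction`, as the derivative of its gradient. -/
noncomputable def twistHessian (C T : E →L[ℝ] E) (m φ : ℝ) (p : WithLp 2 (E × ℝ)) :
    WithLp 2 (E × ℝ) →L[ℝ] WithLp 2 (E × ℝ) :=
  (WithLp.prodContinuousLinearEquiv 2 ℝ E ℝ).symm.toContinuousLinearMap ∘L
    (horizontalTwistHessian C T m φ p).prod
      (m • innerSL ℝ (twistGradient C T m (φ + Real.pi / 2) p))

section Smoothness

variable (m φ : ℝ)

theorem hasFDerivAt_rotatedReflection_apply (p : WithLp 2 (E × ℝ)) :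
    HasFDerivAt (fun q : WithLp 2 (E × ℝ) => rotatedReflection C T (m * q.snd + φ) q.fst)
      (horizontalTwistHessian C T m φ p) p := by
  have hphase : HasFDerivAt (fun q : WithLp 2 (E × ℝ) => m * q.snd + φ)
      (m • WithLp.sndL 2 ℝ E ℝ) p :=
    ((WithLp.sndL 2 ℝ E ℝ).hasFDerivAt.const_mul m).add_const φ
  have hreflection := (hasDerivAt_rotatedReflection (C := C) (T := T)
    (m * p.snd + φ)).hasFDerivAt.comp p hphase
  refine (hreflection.clm_apply (WithLp.fstL 2 ℝ E ℝ).hasFDerivAt).congr_fderiv ?_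
  ext X
  simp [horizontalTwistHessian, mul_smul]

theorem contDiff_rotatedReflection_apply :
    ContDiff ℝ ∞ (fun q : WithLp 2 (E × ℝ) => rotatedReflection C T (m * q.snd + φ) q.fst) :=
  (contDiff_rotatedReflection.comp ((contDiff_const.mul (WithLp.sndL 2 ℝ E ℝ).contDiff).add
    contDiff_const)).clm_apply (WithLp.fstL 2 ℝ E ℝ).contDiff

theorem contDiff_twistFunction : ContDiff ℝ ∞ (twistFunction C T m φ) :=
  contDiff_const.mul ((contDiff_rotatedReflection_apply m φ).inner ℝ
    (WithLp.fstL 2 ℝ E ℝ).contDiff)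

theorem contDiff_twistGradient : ContDiff ℝ ∞ (twistGradient C T m φ) :=
  (WithLp.prodContinuousLinearEquiv 2 ℝ E ℝ).symm.contDiff.comp
    ((contDiff_rotatedReflection_apply m φ).prodMk
      (contDiff_const.mul (contDiff_twistFunction m (φ + Real.pi / 2))))

end Smoothness

variable {m φ : ℝ}

theorem twistFunction_eq_zero_iff {p : WithLp 2 (E × ℝ)} :
    twistFunction C T m φ p = 0 ↔ ⟪rotatedReflection C T (m * p.snd + φ) p.fst, p.fst⟫ = 0 := by
  simp [twistFunction]

theorem twistFunction_add_pi (p : WithLp 2 (E × ℝ)) :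
    twistFunction C T m (φ + Real.pi) p = -twistFunction C T m φ p := by
  simp [twistFunction, ← add_assoc, rotatedReflection_add_pi]

namespace IsCliffordPair

theorem hasFDerivAt_twistFunction (h : IsCliffordPair C T) (p : WithLp 2 (E × ℝ)) :
    HasFDerivAt (twistFunction C T m φ) (innerSL ℝ (twistGradient C T m φ p)) p := by
  refine (((hasFDerivAt_rotatedReflection_apply m φ p).inner ℝ
    (WithLp.fstL 2 ℝ E ℝ).hasFDerivAt).const_mul (1 / 2)).congr_fderiv ?_
  refine ContinuousLinearMap.ext fun X => ?_
  have hsymm : ⟪rotatedReflection C T (m * p.snd + φ) X.fst, p.fst⟫ =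
      ⟪rotatedReflection C T (m * p.snd + φ) p.fst, X.fst⟫ := by
    rw [(h.isOrthogonalReflection_rotatedReflection _).inner_apply_left, real_inner_comm]
  rw [innerSL_apply_apply, inner_withLp_prod]
  simp only [smul_apply, ContinuousLinearMap.comp_apply, ContinuousLinearMap.prod_apply,
    fderivInnerCLM_apply, horizontalTwistHessian, add_apply,
    ContinuousLinearMap.smulRight_apply, WithLp.fstL_apply, WithLp.sndL_apply, smul_eq_mul,
    inner_add_left, real_inner_smul_left, hsymm, twistGradient, twistFunction, add_assoc,
    WithLp.toLp_fst, WithLp.toLp_snd]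
  ring

theorem hasFDerivAt_twistGradient (h : IsCliffordPair C T) (p : WithLp 2 (E × ℝ)) :
    HasFDerivAt (twistGradient C T m φ) (twistHessian C T m φ p) p :=
  (WithLp.prodContinuousLinearEquiv 2 ℝ E ℝ).symm.toContinuousLinearMap.hasFDerivAt.comp p
    ((hasFDerivAt_rotatedReflection_apply m φ p).prodMk
      ((h.hasFDerivAt_twistFunction p).const_mul m))

end IsCliffordPair

variable {p : WithLp 2 (E × ℝ)}

theorem twistHessian_apply (hp : twistFunction C T m φ p = 0) (X : WithLp 2 (E × ℝ)) :
    twistHessian C T m φ p X = WithLp.toLp 2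
      (rotatedReflection C T (m * p.snd + φ) X.fst +
        (m * X.snd) • rotatedReflection C T (m * p.snd + φ + Real.pi / 2) p.fst,
      m * ⟪rotatedReflection C T (m * p.snd + φ + Real.pi / 2) p.fst, X.fst⟫) := by
  have hgradient : twistGradient C T m (φ + Real.pi / 2) p =
      WithLp.toLp 2 (rotatedReflection C T (m * p.snd + φ + Real.pi / 2) p.fst, 0) := by
    rw [twistGradient, add_assoc φ, add_halves, twistFunction_add_pi, hp, neg_zero, mul_zero,
      ← add_assoc]
  refine withLp_prod_ext rfl ?_
  change m * ⟪twistGradient C T m (φ + Real.pi / 2) p, X⟫ = _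
  rw [hgradient, inner_withLp_prod]
  simp

namespace IsCliffordPair

theorem twistGradient_fst_ne_zero (h : IsCliffordPair C T) (hp : p.fst ≠ 0) :
    (twistGradient C T m φ p).fst ≠ 0 := fun h0 =>
  hp <| (h.isOrthogonalReflection_rotatedReflection _).involutive.injective <|
    h0.trans (map_zero _).symm

theorem trace_twistHessian [FiniteDimensional ℝ E] (h : IsCliffordPair C T)
    (hp : twistFunction C T m φ p = 0) :
    LinearMap.trace ℝ _ (twistHessian C T m φ p).toLinearMap = 0 := by
  rw [trace_withLp_prod _ (A := (rotatedReflection C T (m * p.snd + φ)).toLinearMap)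
    fun v => by simp [twistHessian_apply hp], (h.rotate _).trace_left]
  simp [twistHessian_apply hp, verticalVector]

theorem trace_heightReflection_comp_twistHessian [FiniteDimensional ℝ E]
    (h : IsCliffordPair C T) (hp : twistFunction C T m φ p = 0) :
    LinearMap.trace ℝ _ (heightReflection ∘L twistHessian C T m φ p).toLinearMap = 0 := by
  rw [trace_withLp_prod _ (A := (rotatedReflection C T (m * p.snd + φ)).toLinearMap)
    fun v => by simp [twistHessian_apply hp, heightReflection_apply], (h.rotate _).trace_left]
  simp [twistHessian_apply hp, heightReflection_apply, verticalVector]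

/-- The gradient itself, `∂_t` and the gradient of the height function are such vectors `X`. -/
theorem inner_twistHessian_eq_zero (h : IsCliffordPair C T) (hp : twistFunction C T m φ p = 0)
    {X : WithLp 2 (E × ℝ)} {α : ℝ} (hX : X.fst = α • (twistGradient C T m φ p).fst) :
    ⟪twistHessian C T m φ p X, X⟫ = 0 := by
  have hA := (h.isOrthogonalReflection_rotatedReflection (m * p.snd + φ)).involutive p.fst
  have hAB := (h.rotate (m * p.snd + φ)).inner_left_right p.fst
  have hAx := twistFunction_eq_zero_iff.1 hp
  rw [real_inner_comm] at hAB hAx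
  have hX' : X.fst = α • rotatedReflection C T (m * p.snd + φ) p.fst := hX
  rw [inner_withLp_prod, twistHessian_apply hp]
  simp only [WithLp.toLp_fst, WithLp.toLp_snd, hX', map_smul, hA, inner_add_left,
    real_inner_smul_left, real_inner_smul_right, hAB, hAx]
  ring

end IsCliffordPair

end TwistFunctions

section TwistHypersurfaces

variable {E : Type*} [NormedAddCommGroup E] [InnerProductSpace ℝ E] {C T : E →L[ℝ] E}

/-- The cone of nonzero vectors on which the quadratic form `⟪A x, x⟫` vanishes. The vertex is
removed because the cone is not smooth there. -/
def isotropicCone (A : E →L[ℝ] E) : Set E := {x | x ≠ 0 ∧ ⟪A x, x⟫ = 0}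

/-- The part in `M × ℝ` of the hypersurface swept out by the isotropic cones of a reflection that
rotates at speed `m` from the phase `φ` as the height grows. -/
def twistHypersurface (M : Set E) (C T : E →L[ℝ] E) (m φ : ℝ) : Set (WithLp 2 (E × ℝ)) :=
  {p | p.fst ∈ M ∧ p.fst ∈ isotropicCone (rotatedReflection C T (m * p.snd + φ))}

/-- The isotropic cones of the reflections `cos φ C + sin φ T` cut the level set `M`, with
gradients `y`, orthogonally, and those gradients are isotropic for the reflections along the
intersection. Unit spheres and the whole space are the examples in use. -/
structure IsTwistAmbient {ι : Type*} (M : Set E) (y : ι → E → E) (C T : E →L[ℝ] E) : Prop where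
  cliffordPair : IsCliffordPair C T
  levelSet : IsOrthogonalLevelSet M y
  inner_eq_zero : ∀ φ, ∀ x ∈ M, x ∈ isotropicCone (rotatedReflection C T φ) → ∀ i,
    ⟪rotatedReflection C T φ x, y i x⟫ = 0
  inner_apply_eq_zero : ∀ φ, ∀ x ∈ M, x ∈ isotropicCone (rotatedReflection C T φ) → ∀ i,
    ⟪rotatedReflection C T φ (y i x), y i x⟫ = 0

variable {ι : Type*} {M : Set E} {y : ι → E → E} {m φ : ℝ} {p : WithLp 2 (E × ℝ)}

theorem mem_twistHypersurface_iff : p ∈ twistHypersurface M C T m φ ↔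
    p.fst ∈ M ∧ p.fst ≠ 0 ∧ twistFunction C T m φ p = 0 := by
  rw [twistFunction_eq_zero_iff]
  rfl

theorem horizontalSlice_inter_twistHypersurface (t : ℝ) :
    horizontalSlice M t ∩ twistHypersurface M C T m φ =
      horizontalSlice M t ∩ twistHypersurface M C T 0 (m * t + φ) := by
  ext p
  refine and_congr_right fun hp => ?_
  simp only [twistHypersurface, Set.mem_ofPred_eq, hp.2, zero_mul, zero_add]

namespace IsTwistAmbient

theorem inner_twistGradient_horizontalLift (h : IsTwistAmbient M y C T)
    (hp : p ∈ twistHypersurface M C T m φ) (i : ι) :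
    ⟪twistGradient C T m φ p, horizontalLift y i p⟫ = 0 :=
  (inner_horizontalLift _ _ _).trans (h.inner_eq_zero _ _ hp.1 hp.2 i)

theorem inner_twistHessian_horizontalLift (h : IsTwistAmbient M y C T)
    (hp : p ∈ twistHypersurface M C T m φ) (i : ι) :
    ⟪twistHessian C T m φ p (horizontalLift y i p), horizontalLift y i p⟫ = 0 := by
  rw [inner_horizontalLift, twistHessian_apply (mem_twistHypersurface_iff.1 hp).2.2]
  simpa [horizontalLift] using h.inner_apply_eq_zero _ _ hp.1 hp.2 i

theorem isLevelHypersurface (h : IsTwistAmbient M y C T) (m φ : ℝ) :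
    IsLevelHypersurface (cylinder M) (twistHypersurface M C T m φ) (horizontalLift y)
      (twistGradient C T m φ) :=
  h.levelSet.cylinder.isLevelHypersurface (fun _ hq => hq.1)
    (isOpen_ne.preimage (WithLp.fstL 2 ℝ E ℝ).continuous)
    (contDiff_twistFunction m φ).contDiffOn
    (fun _ hq => mem_twistHypersurface_iff.trans (and_iff_right hq))
    (fun q _ => h.cliffordPair.hasFDerivAt_twistFunction q)
    (fun _ hq h0 => h.cliffordPair.twistGradient_fst_ne_zero hq.2.1 (congrArg WithLp.fst h0))
    fun _ hq => h.inner_twistGradient_horizontalLift hq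

theorem isLevelHypersurface_horizontalSlice (h : IsTwistAmbient M y C T) (t φ : ℝ) :
    IsLevelHypersurface (horizontalSlice M t)
      (horizontalSlice M t ∩ twistHypersurface M C T 0 φ)
      (Option.elim' (fun _ => verticalVector) (horizontalLift y)) (twistGradient C T 0 φ) := by
  refine (h.levelSet.horizontalSlice t).isLevelHypersurface Set.inter_subset_left
    ((isOpen_ne (x := 0)).preimage (WithLp.fstL 2 ℝ E ℝ).continuous)
    (contDiff_twistFunction 0 φ).contDiffOn (fun q hq => ?_)
    (fun q _ => h.cliffordPair.hasFDerivAt_twistFunction q)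
    (fun q hq h0 => h.cliffordPair.twistGradient_fst_ne_zero hq.2.2.1 (congrArg WithLp.fst h0))
    fun q hq => Option.forall.2 ⟨?_, h.inner_twistGradient_horizontalLift hq.2⟩
  · exact (and_iff_right hq).trans (mem_twistHypersurface_iff.trans (and_iff_right hq.1))
  · exact (inner_verticalVector _).trans (zero_mul _)

variable [FiniteDimensional ℝ E]

theorem meanCurvature_eq_zero [Finite ι] (h : IsTwistAmbient M y C T)
    {W : Set (WithLp 2 (E × ℝ))} (hW : IsOpen W) {N : WithLp 2 (E × ℝ) → WithLp 2 (E × ℝ)}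
    (hN : IsUnitNormalField (cylinder M) (twistHypersurface M C T m φ ∩ W) N)
    (hp : p ∈ twistHypersurface M C T m φ ∩ W) :
    meanCurvature (cylinder M) (twistHypersurface M C T m φ ∩ W) N p = 0 :=
  have hp0 := (mem_twistHypersurface_iff.1 hp.1).2.2
  ((h.isLevelHypersurface m φ).inter hW).meanCurvature_eq_zero hN hp
    (h.cliffordPair.hasFDerivAt_twistGradient p) (h.cliffordPair.trace_twistHessian hp0)
    (h.cliffordPair.inner_twistHessian_eq_zero hp0 (one_smul ℝ _).symm)
    (h.inner_twistHessian_horizontalLift hp.1)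

theorem lorentzMeanCurvature_eq_zero [Finite ι] (h : IsTwistAmbient M y C T)
    {W : Set (WithLp 2 (E × ℝ))} (hW : IsOpen W) {N : WithLp 2 (E × ℝ) → WithLp 2 (E × ℝ)}
    (hN : IsLorentzUnitNormalField M (twistHypersurface M C T m φ ∩ W) N)
    (hp : p ∈ twistHypersurface M C T m φ ∩ W) :
    lorentzMeanCurvature M (twistHypersurface M C T m φ ∩ W) N p = 0 :=
  have hp0 := (mem_twistHypersurface_iff.1 hp.1).2.2
  ((h.isLevelHypersurface m φ).inter hW).lorentzMeanCurvature_eq_zero hN hp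
    (h.cliffordPair.hasFDerivAt_twistGradient p)
    (h.cliffordPair.trace_heightReflection_comp_twistHessian hp0)
    (h.cliffordPair.inner_twistHessian_eq_zero hp0 (one_smul ℝ _).symm)
    (h.inner_twistHessian_horizontalLift hp.1)

theorem card_lt_finrank [Fintype ι] (h : IsTwistAmbient M y C T)
    (hp : p ∈ twistHypersurface M C T m φ) : Fintype.card ι < Module.finrank ℝ E := by
  have hslice : p ∈ horizontalSlice M p.snd ∩ twistHypersurface M C T m φ := ⟨⟨hp.1, rfl⟩, hp⟩
  rw [horizontalSlice_inter_twistHypersurface] at hslice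
  have hcard := (h.isLevelHypersurface_horizontalSlice _ _).levelSet.card_le_finrank hslice
  rw [Fintype.card_option, Fintype.card_option, finrank_withLp_prod] at hcard
  omega

theorem isMinimalHypersurface_horizontalSlice [Fintype ι] (h : IsTwistAmbient M y C T)
    (hι : Fintype.card ι < Module.finrank ℝ E) (t : ℝ) :
    IsMinimalHypersurface (horizontalSlice M t)
      (horizontalSlice M t ∩ twistHypersurface M C T m φ) := by
  rw [horizontalSlice_inter_twistHypersurface]
  have hS := h.isLevelHypersurface_horizontalSlice t (m * t + φ)
  refine ⟨hS.isEmbeddedHypersurface ?_, fun W hW N hN p hp => ?_⟩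
  · rw [Fintype.card_option, finrank_withLp_prod]
    omega
  · have hp0 := (mem_twistHypersurface_iff.1 hp.1.2).2.2
    refine (hS.inter hW).meanCurvature_eq_zero hN hp (h.cliffordPair.hasFDerivAt_twistGradient p)
      (h.cliffordPair.trace_twistHessian hp0)
      (h.cliffordPair.inner_twistHessian_eq_zero hp0 (one_smul ℝ _).symm)
      (Option.forall.2 ⟨?_, h.inner_twistHessian_horizontalLift hp.1.2⟩)
    exact h.cliffordPair.inner_twistHessian_eq_zero hp0 (zero_smul ℝ _).symm

theorem inner_shapeOperator_heightGradient_eq_zero [Finite ι] (h : IsTwistAmbient M y C T)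
    {N : WithLp 2 (E × ℝ) → WithLp 2 (E × ℝ)}
    (hN : IsUnitNormalField (cylinder M) (twistHypersurface M C T m φ) N)
    (hp : p ∈ twistHypersurface M C T m φ) :
    ⟪shapeOperator (cylinder M) (twistHypersurface M C T m φ) N p
      (heightGradient (twistHypersurface M C T m φ) p),
      heightGradient (twistHypersurface M C T m φ) p⟫ = 0 := by
  have hS := h.isLevelHypersurface m φ
  have hfst : (heightGradient (twistHypersurface M C T m φ) p : WithLp 2 (E × ℝ)).fst =
      (-((twistGradient C T m φ p).snd / ⟪twistGradient C T m φ p, twistGradient C T m φ p⟫)) •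
        (twistGradient C T m φ p).fst := by
    rw [hS.coe_heightGradient hp]
    simp [verticalVector]
  rw [hS.inner_shapeOperator_heightGradient hN hp (h.cliffordPair.hasFDerivAt_twistGradient p),
    h.cliffordPair.inner_twistHessian_eq_zero (mem_twistHypersurface_iff.1 hp).2.2 hfst, mul_zero,
    neg_zero]

theorem isVerticalHelicoid [Finite ι] (h : IsTwistAmbient M y C T) {q : WithLp 2 (E × ℝ)}
    (hp : p ∈ twistHypersurface M C T m φ) (hp0 : (twistGradient C T m φ p).snd = 0)
    (hq : q ∈ twistHypersurface M C T m φ) (hq0 : (twistGradient C T m φ q).snd ≠ 0) :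
    IsVerticalHelicoid M (twistHypersurface M C T m φ) := by
  have := Fintype.ofFinite ι
  have hS := h.isLevelHypersurface m φ
  have hι := h.card_lt_finrank hp
  exact {
    hypersurface := hS.isEmbeddedHypersurface (by rw [finrank_withLp_prod]; omega)
    orientable := hS.exists_isUnitNormalField (contDiff_twistGradient m φ)
    no_horizontal_point := fun r hr => hS.heightGradient_ne_zero hr
      (h.cliffordPair.twistGradient_fst_ne_zero hr.2.1)
    angle_nonconstant := fun N hN => ⟨p, hp, q, hq, fun hpq => hq0 <|
      (hS.angleFunction_eq_zero_iff hN hq).1 <|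
        hpq.symm.trans ((hS.angleFunction_eq_zero_iff hN hp).2 hp0)⟩
    sections_minimal := h.isMinimalHypersurface_horizontalSlice hι
    asymptotic := fun N hN r hr => h.inner_shapeOperator_heightGradient_eq_zero hN hr }

theorem containsOpenZeroMeanIsocurved [Finite ι] (h : IsTwistAmbient M y C T)
    (hp : p ∈ twistHypersurface M C T m φ)
    (htimelike : lorentzForm (twistGradient C T m φ p) (twistGradient C T m φ p) < 0) :
    ContainsOpenZeroMeanIsocurved M (twistHypersurface M C T m φ) := by
  have := Fintype.ofFinite ι
  let W := {q | lorentzForm (twistGradient C T m φ q) (twistGradient C T m φ q) < 0}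
  have hg := contDiff_twistGradient (C := C) (T := T) m φ
  have hW : IsOpen W := by
    simp only [W, lorentzForm_eq_inner]
    exact isOpen_lt (hg.continuous.inner (heightReflection.continuous.comp hg.continuous))
      continuous_const
  have hS := (h.isLevelHypersurface m φ).inter hW
  have hι := h.card_lt_finrank hp
  exact ⟨W, hW, ⟨p, hp, htimelike⟩, {
    hypersurface := hS.isEmbeddedHypersurface (by rw [finrank_withLp_prod]; omega)
    spacelike := hS.isSpacelike fun _ hq => hq.2
    orientable := hS.exists_isUnitNormalField hg
    lorentz_orientable := hS.exists_isLorentzUnitNormalField hg fun _ hq => hq.2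
    meanCurvature_eq_zero := fun N hN q hq => h.meanCurvature_eq_zero hW hN hq
    lorentzMeanCurvature_eq_zero := fun N hN q hq => h.lorentzMeanCurvature_eq_zero hW hN hq }⟩

end IsTwistAmbient

theorem inner_self_eq_one_iff_mem_sphere {x : E} : ⟪x, x⟫ = 1 ↔ x ∈ Metric.sphere (0 : E) 1 := by
  rw [mem_sphere_zero_iff_norm, real_inner_self_eq_norm_sq,
    pow_eq_one_iff_of_nonneg (norm_nonneg x) two_ne_zero]

theorem isOrthogonalLevelSet_sphere :
    IsOrthogonalLevelSet (Metric.sphere (0 : E) 1) (fun (_ : Unit) x => x) where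
  exists_equations := by
    refine ⟨Set.univ, isOpen_univ, Set.subset_univ _, fun _ x => 1 / 2 * (⟪x, x⟫ - 1),
      fun _ => (contDiff_const.mul ((contDiff_id.inner ℝ contDiff_id).sub
        contDiff_const)).contDiffOn, fun x _ => ?_, fun x _ _ => ?_⟩
    · rw [← inner_self_eq_one_iff_mem_sphere, forall_const, mul_eq_zero_iff_left one_half_pos.ne',
        sub_eq_zero]
    · refine ((((hasFDerivAt_id x).inner ℝ (hasFDerivAt_id x)).sub_const 1).const_mul
        (1 / 2)).congr_fderiv (ContinuousLinearMap.ext fun v => ?_)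
      simp [fderivInnerCLM_apply, real_inner_comm x v]
      ring
  ne_zero x hx _ := ne_zero_of_mem_unit_sphere (⟨x, hx⟩ : Metric.sphere (0 : E) 1)
  pairwise_inner _ _ := Subsingleton.pairwise

namespace IsCliffordPair

theorem isTwistAmbient_sphere (h : IsCliffordPair C T) :
    IsTwistAmbient (Metric.sphere 0 1) (fun (_ : Unit) x => x) C T where
  cliffordPair := h
  levelSet := isOrthogonalLevelSet_sphere
  inner_eq_zero _ _ _ hx _ := hx.2
  inner_apply_eq_zero _ _ _ hx _ := hx.2

theorem isTwistAmbient_univ (h : IsCliffordPair C T) :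
    IsTwistAmbient Set.univ (fun (i : Empty) _ => i.elim) C T where
  cliffordPair := h
  levelSet := .univ
  inner_eq_zero _ _ _ _ i := i.elim
  inner_apply_eq_zero _ _ _ _ i := i.elim

end IsCliffordPair

end TwistHypersurfaces

section Twistings

variable {E : Type*} [NormedAddCommGroup E] [InnerProductSpace ℝ E] {C T : E →L[ℝ] E}

namespace IsCliffordPair

theorem rotatedReflection_apply_left_mem_isotropicCone_iff (h : IsCliffordPair C T) (θ : ℝ)
    {x : E} : rotatedReflection C T θ (C x) ∈ isotropicCone (rotatedReflection C T (2 * θ)) ↔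
      x ∈ isotropicCone C := by
  have hA := h.isOrthogonalReflection_rotatedReflection θ
  have hne : rotatedReflection C T θ (C x) ≠ 0 ↔ x ≠ 0 := by
    rw [← norm_ne_zero_iff, hA.norm_apply, h.left.norm_apply, norm_ne_zero_iff]
  refine and_congr hne ?_
  rw [h.rotatedReflection_rotatedReflection, two_mul, add_sub_cancel_right, h.left.involutive,
    hA.inner_apply_apply, real_inner_comm]

theorem pitchedTwisting_inter_isotropicCone (h : IsCliffordPair C T) {a : ℝ} (ha : a ≠ 0) (k : ℝ)
    {M : Set E} (hM : ∀ θ x, rotatedReflection C T θ (C x) ∈ M ↔ x ∈ M) :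
    pitchedTwisting a (fun s x => rotatedReflection C T (k * s) (C x)) (M ∩ isotropicCone C) =
      twistHypersurface M C T (2 * k / a) 0 := by
  have hmem (s : ℝ) (x : E) : WithLp.toLp 2 (rotatedReflection C T (k * s) (C x), a * s) ∈
      twistHypersurface M C T (2 * k / a) 0 ↔ x ∈ M ∩ isotropicCone C := by
    have hphase : 2 * k / a * (a * s) + 0 = 2 * (k * s) := by field_simp; ring
    refine and_congr (hM _ x) ?_
    rw [WithLp.toLp_snd, hphase]
    exact h.rotatedReflection_apply_left_mem_isotropicCone_iff _
  refine Set.Subset.antisymm ?_ fun p hp => ?_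
  · rintro _ ⟨x, hx, s, rfl⟩
    exact (hmem s x).2 hx
  · have hp' : p = WithLp.toLp 2 (rotatedReflection C T (k * (p.snd / a))
        (C (C (rotatedReflection C T (k * (p.snd / a)) p.fst))), a * (p.snd / a)) := by
      rw [h.left.involutive, (h.isOrthogonalReflection_rotatedReflection _).involutive,
        mul_div_cancel₀ _ ha]
      rfl
    exact ⟨_, (hmem _ _).1 (hp' ▸ hp), _, hp'⟩

theorem rotatedReflection_apply_left_mem_sphere_iff (h : IsCliffordPair C T) (θ : ℝ) (x : E) :
    rotatedReflection C T θ (C x) ∈ Metric.sphere (0 : E) 1 ↔ x ∈ Metric.sphere (0 : E) 1 := by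
  rw [mem_sphere_zero_iff_norm, mem_sphere_zero_iff_norm,
    (h.isOrthogonalReflection_rotatedReflection θ).norm_apply, h.left.norm_apply]

end IsCliffordPair

theorem smul_mem_isotropicCone {A : E →L[ℝ] E} {x : E} (hx : x ∈ isotropicCone A) {r : ℝ}
    (hr : r ≠ 0) : r • x ∈ isotropicCone A := by
  refine ⟨smul_ne_zero hr hx.1, ?_⟩
  rw [map_smul, real_inner_smul_left, real_inner_smul_right, hx.2, mul_zero, mul_zero]

theorem coneOver_sphere_inter_isotropicCone (A : E →L[ℝ] E) :
    coneOver (Metric.sphere 0 1 ∩ isotropicCone A) = isotropicCone A := by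
  refine Set.Subset.antisymm ?_ fun x hx => ?_
  · rintro _ ⟨r, hr, x, hx, rfl⟩
    exact smul_mem_isotropicCone hx.2 hr.ne'
  · have hx0 := norm_ne_zero_iff.2 hx.1
    refine ⟨‖x‖, norm_pos_iff.2 hx.1, ‖x‖⁻¹ • x,
      ⟨?_, smul_mem_isotropicCone hx (inv_ne_zero hx0)⟩, (smul_inv_smul₀ hx0 x).symm⟩
    rw [mem_sphere_zero_iff_norm, norm_smul, norm_inv, norm_norm, inv_mul_cancel₀ hx0]

theorem isClosed_twistHypersurface {M : Set E} (hM : IsClosed M) (h0 : (0 : E) ∉ M) (m φ : ℝ) :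
    IsClosed (twistHypersurface M C T m φ) := by
  have hset : twistHypersurface M C T m φ =
      (WithLp.fstL 2 ℝ E ℝ) ⁻¹' M ∩ twistFunction C T m φ ⁻¹' {0} :=
    Set.ext fun p => mem_twistHypersurface_iff.trans <| and_congr_right fun hp =>
      and_iff_right (ne_of_mem_of_not_mem hp h0)
  rw [hset]
  exact (hM.preimage (WithLp.fstL 2 ℝ E ℝ).continuous).inter
    (isClosed_singleton.preimage (contDiff_twistFunction m φ).continuous)

end Twistings

section BlockReflections

theorem exp_smul_eq_cos_add_sin {A : Type*} [Ring A] [Algebra ℝ A] [TopologicalSpace A]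
    [IsTopologicalRing A] [ContinuousSMul ℝ A] [T2Space A] {J : A} (hJ : J * J = -1) (θ : ℝ) :
    NormedSpace.exp (θ • J) = Real.cos θ • 1 + Real.sin θ • J := by
  let ψ : ℂ →ₐ[ℝ] A := Complex.liftAux J hJ
  have hψ : Continuous ψ := ψ.toLinearMap.continuous_of_finiteDimensional
  have hexp (z : ℂ) : NormedSpace.exp (ψ z) = ψ (NormedSpace.exp z) := by
    rw [NormedSpace.exp_eq_tsum ℝ, NormedSpace.exp_eq_tsum ℝ]
    refine Eq.trans ?_ ((NormedSpace.expSeries_summable' (𝕂 := ℝ) z).hasSum.map ψ hψ).tsum_eq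
    simp only [Function.comp_def, map_smul, map_pow]
  have hI : θ • J = ψ (θ * Complex.I) := by
    simp [ψ, Complex.liftAux_apply]
  rw [hI, hexp, ← Complex.exp_eq_exp_ℂ, Complex.exp_mul_I]
  simp [ψ, Complex.liftAux_apply, Algebra.algebraMap_eq_smul_one, ← Complex.ofReal_cos,
    ← Complex.ofReal_sin]

open Matrix in
theorem isOrthogonalReflection_toEuclideanCLM {m : Type*} [Fintype m] [DecidableEq m]
    {A : Matrix m m ℝ} (hA : A.IsHermitian) (hsq : A * A = 1) :
    IsOrthogonalReflection (toEuclideanCLM (𝕜 := ℝ) A) where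
  inner_apply_left x y := by
    rw [← ContinuousLinearMap.adjoint_inner_right, ← ContinuousLinearMap.star_eq_adjoint,
      ← map_star, star_eq_conjTranspose, hA.eq]
  involutive x := by
    rw [← mul_apply_eq_comp, ← map_mul, hsq, map_one, one_apply_eq_self]

variable {ι : Type*} [Fintype ι] [DecidableEq ι]

/-- The reflection `(x, y) ↦ (x, -y)`. Its isotropic cone is the cone over the Clifford torus. -/
noncomputable def blockConj (ι : Type*) [Fintype ι] [DecidableEq ι] :
    EuclideanSpace ℝ (ι ⊕ ι) →L[ℝ] EuclideanSpace ℝ (ι ⊕ ι) :=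
  Matrix.toEuclideanCLM (𝕜 := ℝ) (Matrix.fromBlocks 1 0 0 (-1))

/-- The reflection `(x, y) ↦ (y, x)`. Composed after `blockConj` it is the rotation `J`. -/
noncomputable def blockSwap (ι : Type*) [Fintype ι] [DecidableEq ι] :
    EuclideanSpace ℝ (ι ⊕ ι) →L[ℝ] EuclideanSpace ℝ (ι ⊕ ι) :=
  Matrix.toEuclideanCLM (𝕜 := ℝ) (Matrix.fromBlocks 0 1 1 0)

theorem isCliffordPair_blockConj_blockSwap : IsCliffordPair (blockConj ι) (blockSwap ι) where
  left := isOrthogonalReflection_toEuclideanCLM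
    (Matrix.IsHermitian.fromBlocks (by simp) (by simp) (by simp))
    (by simp [Matrix.fromBlocks_multiply])
  right := isOrthogonalReflection_toEuclideanCLM
    (Matrix.IsHermitian.fromBlocks (by simp) (by simp) (by simp))
    (by simp [Matrix.fromBlocks_multiply])
  anticomm x := by
    rw [blockConj, blockSwap, ← mul_apply_eq_comp, ← mul_apply_eq_comp,
      ← map_mul, ← map_mul, ← neg_apply, ← map_neg]
    simp [Matrix.fromBlocks_multiply, Matrix.fromBlocks_neg]

theorem toEuclideanLin_exp_smul_J (θ : ℝ) (x : EuclideanSpace ℝ (ι ⊕ ι)) :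
    Matrix.toEuclideanLin (NormedSpace.exp (θ • Matrix.J ι ℝ)) x =
      rotatedReflection (blockConj ι) (blockSwap ι) θ (blockConj ι x) := by
  have hJ : Matrix.J ι ℝ = Matrix.fromBlocks 0 1 1 0 * Matrix.fromBlocks 1 0 0 (-1) := by
    simp [Matrix.J, Matrix.fromBlocks_multiply]
  have hswap : blockSwap ι (blockConj ι x) = Matrix.toEuclideanLin (Matrix.J ι ℝ) x := by
    rw [hJ, blockConj, blockSwap, ← mul_apply_eq_comp, ← map_mul]
    rfl
  rw [exp_smul_eq_cos_add_sin (Matrix.J_squared ι ℝ), rotatedReflection_apply,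
    isCliffordPair_blockConj_blockSwap.left.involutive, hswap]
  simp

theorem inner_blockConj_self (x : EuclideanSpace ℝ (ι ⊕ ι)) :
    ⟪blockConj ι x, x⟫ = ∑ i, x (Sum.inl i) ^ 2 - ∑ i, x (Sum.inr i) ^ 2 := by
  simp [blockConj, PiLp.inner_apply, Matrix.fromBlocks_mulVec, sq, Matrix.neg_mulVec,
    sub_eq_add_neg]

theorem inner_blockSwap_self (x : EuclideanSpace ℝ (ι ⊕ ι)) :
    ⟪blockSwap ι x, x⟫ = 2 * ∑ i, x (Sum.inl i) * x (Sum.inr i) := by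
  simp [blockSwap, PiLp.inner_apply, Matrix.fromBlocks_mulVec, two_mul, mul_comm]

end BlockReflections

section TwistedCliffordTori

variable {n : ℕ} {a k : ℝ}

theorem cliffordTorus_eq :
    cliffordTorus n = oddSphere n ∩ isotropicCone (blockConj (Fin (n + 1))) := by
  have hsphere (v : Fin (n + 1) → ℝ) : (WithLp.toLp 2 v : EuclideanSpace ℝ (Fin (n + 1))) ∈
      Metric.sphere 0 (1 / √2) ↔ ∑ i, v i ^ 2 = 1 / 2 := by
    rw [mem_sphere_zero_iff_norm, ← sq_eq_sq₀ (norm_nonneg _) (by positivity),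
      EuclideanSpace.real_norm_sq_eq, div_pow, Real.sq_sqrt zero_le_two, one_pow]
  ext p
  have hp : p ∈ oddSphere n ∩ isotropicCone (blockConj (Fin (n + 1))) ↔
      ⟪p, p⟫ = 1 ∧ ⟪blockConj (Fin (n + 1)) p, p⟫ = 0 := by
    rw [inner_self_eq_one_iff_mem_sphere]
    exact and_congr_right fun h =>
      and_iff_right (ne_zero_of_mem_unit_sphere (⟨p, h⟩ : Metric.sphere (0 : DoubleSpace n) 1))
  rw [hp, inner_blockConj_self, real_inner_self_eq_norm_sq, EuclideanSpace.real_norm_sq_eq,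
    Fintype.sum_sum_type, cliffordTorus, Set.mem_ofPred_eq, hsphere, hsphere]
  constructor <;> rintro ⟨hx, hy⟩ <;> constructor <;> linarith

theorem rotationGroup_eq (k : ℝ) : rotationGroup n k = fun s p =>
    rotatedReflection (blockConj (Fin (n + 1))) (blockSwap (Fin (n + 1))) (k * s)
      (blockConj (Fin (n + 1)) p) :=
  funext₂ fun _ _ => toEuclideanLin_exp_smul_J _ _

theorem twistedCliffordTorus_eq (ha : a ≠ 0) (k : ℝ) : twistedCliffordTorus n a k =
    twistHypersurface (oddSphere n) (blockConj (Fin (n + 1))) (blockSwap (Fin (n + 1)))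
      (2 * k / a) 0 := by
  rw [twistedCliffordTorus, rotationGroup_eq, cliffordTorus_eq]
  exact isCliffordPair_blockConj_blockSwap.pitchedTwisting_inter_isotropicCone ha k
    isCliffordPair_blockConj_blockSwap.rotatedReflection_apply_left_mem_sphere_iff

theorem twistedCliffordCone_eq (ha : a ≠ 0) (k : ℝ) : twistedCliffordCone n a k =
    twistHypersurface Set.univ (blockConj (Fin (n + 1))) (blockSwap (Fin (n + 1)))
      (2 * k / a) 0 := by
  rw [twistedCliffordCone, rotationGroup_eq, cliffordTorus_eq, oddSphere,
    coneOver_sphere_inter_isotropicCone, ← Set.univ_inter (isotropicCone _)]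
  exact isCliffordPair_blockConj_blockSwap.pitchedTwisting_inter_isotropicCone ha k
    fun _ _ => Iff.rfl

end TwistedCliffordTori

section CliffordPoints

variable {ι : Type*} [Fintype ι] [DecidableEq ι]

/-- The point of the Clifford torus with components `e_i / √2` and `e_j / √2`. -/
noncomputable def cliffordPoint (i j : ι) : EuclideanSpace ℝ (ι ⊕ ι) :=
  WithLp.toLp 2 (Sum.elim (Pi.single i (√2)⁻¹) (Pi.single j (√2)⁻¹))

theorem inner_self_cliffordPoint (i j : ι) : ⟪cliffordPoint i j, cliffordPoint i j⟫ = 1 := by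
  rw [real_inner_self_eq_norm_sq, EuclideanSpace.real_norm_sq_eq, Fintype.sum_sum_type]
  simp [cliffordPoint, Pi.single_apply]
  norm_num

theorem inner_blockConj_cliffordPoint (i j : ι) :
    ⟪blockConj ι (cliffordPoint i j), cliffordPoint i j⟫ = 0 := by
  rw [inner_blockConj_self]
  simp [cliffordPoint, Pi.single_apply]

theorem inner_blockSwap_cliffordPoint (i j : ι) :
    ⟪blockSwap ι (cliffordPoint i j), cliffordPoint i j⟫ = if i = j then 1 else 0 := by
  have hsq : 2 * ((√2)⁻¹ * (√2)⁻¹) = (1 : ℝ) := by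
    rw [← mul_inv, Real.mul_self_sqrt zero_le_two, mul_inv_cancel₀ two_ne_zero]
  rw [inner_blockSwap_self]
  simp [cliffordPoint, Pi.single_apply, hsq, eq_comm]

theorem twistGradient_cliffordPoint (m : ℝ) (i j : ι) :
    twistGradient (blockConj ι) (blockSwap ι) m 0 (WithLp.toLp 2 (cliffordPoint i j, 0)) =
      WithLp.toLp 2 (blockConj ι (cliffordPoint i j), if i = j then m / 2 else 0) := by
  simp [twistGradient, twistFunction, rotatedReflection, inner_blockSwap_cliffordPoint,
    ← div_eq_mul_inv]

variable {κ : Type*} [Finite κ] {M : Set (EuclideanSpace ℝ (ι ⊕ ι))}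
  {y : κ → EuclideanSpace ℝ (ι ⊕ ι) → EuclideanSpace ℝ (ι ⊕ ι)}

theorem toLp_cliffordPoint_mem_twistHypersurface (hM : Metric.sphere 0 1 ⊆ M) (m : ℝ) (i j : ι) :
    WithLp.toLp 2 (cliffordPoint i j, 0) ∈
      twistHypersurface M (blockConj ι) (blockSwap ι) m 0 := by
  have hsphere := inner_self_eq_one_iff_mem_sphere.1 (inner_self_cliffordPoint i j)
  refine ⟨hM hsphere, ne_zero_of_mem_unit_sphere (⟨_, hsphere⟩ :
    Metric.sphere (0 : EuclideanSpace ℝ (ι ⊕ ι)) 1), ?_⟩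
  simp only [WithLp.toLp_fst, WithLp.toLp_snd, mul_zero, add_zero, rotatedReflection_zero,
    inner_blockConj_cliffordPoint]

namespace IsTwistAmbient

theorem isVerticalHelicoid_of_sphere_subset [Nontrivial ι]
    (h : IsTwistAmbient M y (blockConj ι) (blockSwap ι)) (hM : Metric.sphere 0 1 ⊆ M) {m : ℝ}
    (hm : m ≠ 0) : IsVerticalHelicoid M (twistHypersurface M (blockConj ι) (blockSwap ι) m 0) := by
  obtain ⟨i, j, hij⟩ := exists_pair_ne ι
  refine h.isVerticalHelicoid (toLp_cliffordPoint_mem_twistHypersurface hM m i j) ?_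
    (toLp_cliffordPoint_mem_twistHypersurface hM m i i) ?_
  · rw [twistGradient_cliffordPoint, if_neg hij, WithLp.toLp_snd]
  · rw [twistGradient_cliffordPoint, if_pos rfl, WithLp.toLp_snd]
    exact div_ne_zero hm two_ne_zero

theorem containsOpenZeroMeanIsocurved_of_sphere_subset [Nonempty ι]
    (h : IsTwistAmbient M y (blockConj ι) (blockSwap ι)) (hM : Metric.sphere 0 1 ⊆ M) {m : ℝ}
    (hm : 2 < |m|) : ContainsOpenZeroMeanIsocurved M
      (twistHypersurface M (blockConj ι) (blockSwap ι) m 0) := by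
  obtain ⟨i⟩ := ‹Nonempty ι›
  refine h.containsOpenZeroMeanIsocurved (toLp_cliffordPoint_mem_twistHypersurface hM m i i) ?_
  have hslope : 1 < m / 2 * (m / 2) := by
    rw [← abs_mul_abs_self, abs_div, abs_two]
    exact one_lt_mul_of_lt_of_le (by linarith) (by linarith)
  rw [twistGradient_cliffordPoint, if_pos rfl, lorentzForm, WithLp.toLp_fst, WithLp.toLp_snd,
    isCliffordPair_blockConj_blockSwap.left.inner_apply_apply, inner_self_cliffordPoint]
  exact sub_neg.2 hslope

end IsTwistAmbient

end CliffordPoints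

theorem mainTheorem5 (n : ℕ) (hn : 1 ≤ n) :
    (∀ a k : ℝ, 0 < a → 0 < k →
      IsProperlyEmbeddedHypersurface (cylinder (oddSphere n)) (twistedCliffordTorus n a k) ∧
      IsVerticalHelicoid (oddSphere n) (twistedCliffordTorus n a k)) ∧
    (∀ a : ℝ, 0 < a → ∃ k : ℝ, 0 < k ∧
      ContainsOpenZeroMeanIsocurved (oddSphere n) (twistedCliffordTorus n a k)) ∧
    (∀ a k : ℝ, 0 < a → 0 < k →
      IsEmbeddedHypersurface (cylinder Set.univ) (twistedCliffordCone n a k) ∧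
      IsVerticalHelicoid Set.univ (twistedCliffordCone n a k)) ∧
    (∀ a : ℝ, 0 < a → ∃ k : ℝ, 0 < k ∧
      ContainsOpenZeroMeanIsocurved Set.univ (twistedCliffordCone n a k)) := by
  have : Nontrivial (Fin (n + 1)) := Fin.nontrivial_iff_two_le.2 (Nat.succ_le_succ hn)
  have hpair := isCliffordPair_blockConj_blockSwap (ι := Fin (n + 1))
  have hsphere : IsTwistAmbient (oddSphere n) _ _ _ := hpair.isTwistAmbient_sphere
  have hspeed {a k : ℝ} (ha : 0 < a) (hk : 0 < k) : 2 * k / a ≠ 0 := by positivity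
  have hfast {a : ℝ} (ha : 0 < a) : 2 < |2 * (2 * a) / a| := by
    rw [← mul_assoc, mul_div_cancel_right₀ _ ha.ne']
    norm_num
  refine ⟨fun a k ha hk => ?_, fun a ha => ⟨2 * a, by positivity, ?_⟩,
    fun a k ha hk => ?_, fun a ha => ⟨2 * a, by positivity, ?_⟩⟩
  · rw [twistedCliffordTorus_eq ha.ne']
    have hS := hsphere.isVerticalHelicoid_of_sphere_subset subset_rfl (hspeed ha hk)
    exact ⟨hS.hypersurface.isProperlyEmbeddedHypersurface
      (isClosed_twistHypersurface Metric.isClosed_sphere (by simp) _ _), hS⟩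
  · rw [twistedCliffordTorus_eq ha.ne']
    exact hsphere.containsOpenZeroMeanIsocurved_of_sphere_subset subset_rfl (hfast ha)
  · rw [twistedCliffordCone_eq ha.ne']
    have hS := hpair.isTwistAmbient_univ.isVerticalHelicoid_of_sphere_subset
      (Set.subset_univ _) (hspeed ha hk)
    exact ⟨hS.hypersurface, hS⟩
  · rw [twistedCliffordCone_eq ha.ne']
    exact hpair.isTwistAmbient_univ.containsOpenZeroMeanIsocurved_of_sphere_subset
      (Set.subset_univ _) (hfast ha)
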